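/- **Setting.** Let $m\ge 2$ senders and one receiver interact over stages $1,\dots,n$. The state in $\mathbb R^p$ is $x_k=Ax_{k-1}+w_{k-1}$ for $1\le k\le n$, where $x_0\sim\mathbb N(0,\Sigma_0)$ and $w_0,\dots,w_{n-1}\sim\mathbb N(0,\Sigma_w)$ are independent; let $\Sigma_k=A\Sigma_{k-1}A^\top+\Sigma_w$. At stage $k$, sender $i$ sends $y^i_k=\eta^i_k(x_1,\dots,x_k)\in\mathbb R^p$ and the receiver takes the action $u_k=\gamma_k\big((y^i_l)_{i\le m,\,l\le k}\big)\in\mathbb R^t$, with Borel measurable $\eta^i_k,\gamma_k$. Each player $j\in\{1,\dots,m,r\}$ has the costs $J_j^K=\mathbb E\sum_{k=1}^K\|Q_{j,k}x_k+R_{j,k}u_k\|^2$, $1\le K\le n$, and all $R_{r,k}^\top R_{r,k}$ are invertible. The senders commit to their policies first and the receiver reacts. A profile $\eta^*$ with a receiver's reaction map $\eta\mapsto\gamma^*(\eta)$ is a *multistage Nash equilibrium* if, for every profile $\eta$ and every $K\le n$, $\gamma^*(\eta)$ minimizes $J_r^K(\eta,\cdot)$, and, for every $K\le n$, every sender $i$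 and every policy $\eta^i=(\eta^i_k)_k$ (deviations at any set of stages), $J_i^K(\eta^*,\gamma^*(\eta^*))\le J_i^K(\eta^i,\eta^{-i*},\gamma^*(\eta^i,\eta^{-i*}))$. The posterior covariance of a profile at stage $k$ is $\mathbb E[\hat x_k\hat x_k^\top]$ with $\hat x_k=\mathbb E[x_k\mid (y^i_l)_{i\le m,\,l\le k}]$. Let $\Lambda^i_k=R_{i,k}(R_{r,k}^\top R_{r,k})^{-1}R_{r,k}^\top Q_{r,k}$ and $V^i_k=\Lambda_k^{i\top}\Lambda^i_k-\Lambda_k^{i\top}Q_{i,k}-Q_{i,k}^\top\Lambda^i_k$. With $\preceq$ the Loewner order, call $S$ stable for sender $i$ at stage $k$ if $O\preceq S\preceq\Sigma_k$ and $\mathrm{Tr}(V^i_kS)=\min_{S\preceq T\preceq\Sigma_k}\mathrm{Tr}(V^i_kT)$. A sequence $S^*_0=O,S^*_1,\dots,S^*_n$ is a *sequence of stable posteriors* with orthogonal projection matrices $P_1,\dots,P_n$ if, for $1\le k\le n$, $S^*_k$ is stable at stage $k$ for every sender and $$S^*_k=AS^*_{k-1}A^\top+D_k^{1/2}P_kD_k^{1/2},\qquad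 D_k=\Sigma_k-AS^*_{k-1}A^\top .$$ **Statement.** (a) Let $S^*,P$ be a sequence of stable posteriors with its projection matrices and let $D_1,\dots,D_n$ be positive definite. For any eigen-decompositions $P_k=U_k\Lambda_kU_k^\top$ ($U_k$ orthogonal, $\Lambda_k$ diagonal), let $L_k=D_k^{-1/2}U_k\Lambda_k$ and let every sender use the same memoryless linear policy $y_k=L_k^\top x_k$. Then the posterior covariance at each stage $k=1,\dots,n$ is $S^*_k$, and this profile is a multistage Nash equilibrium together with every map that assigns to each profile a best response of the receiver (minimizing $J_r^K$ for all $K\le n$); at least one such map exists. (b) The outcomes of the greedy algorithm are such sequences: fix an order of the senders and, at each stage $k$, starting from $T_0=O$, let the senders $i$ in this order replace the current $T_{j-1}$ by a minimizer $T_j$ of $\mathrm{Tr}(V^i_kT)$ over $T_{j-1}\preceq T\preceq D_k$ that has, among the minimizers, the least nuclear norm $\|D_k^{-1/2}TD_k^{-1/2}\|_*$; put $S^*_k=AS^*_{k-1}A^\top+T_m$, with $S^*_0=O$. If all $D_k$ are positive definite, then $S^*_1,\dots,S^*_n$ are stable posteriors with some projection matrices $P_1,\dots,P_n$. -/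

import Mathlib

open MeasureTheory ProbabilityTheory
open scoped MatrixOrder Matrix ENNReal

noncomputable section

namespace Disclosure

/-- Real square matrices of size `p`. The order `≤` on them is the Loewner order. -/
abbrev Mat (p : ℕ) := Matrix (Fin p) (Fin p) ℝ

/-- Euclidean space of dimension `p`. -/
abbrev Vec (p : ℕ) := EuclideanSpace ℝ (Fin p)

/-- The data of an `m`-sender, one-receiver game of quadratic costs over the stages `1, …, n`.
The state lives in dimension `p`, the receiver's action in dimension `t`.
Only the values of the cost matrices at the stages `1, …, n` are ever used. -/
structure Game (m p t q : ℕ) where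
  /-- the number of stages -/
  n : ℕ
  /-- the matrix of the state dynamics -/
  A : Mat p
  /-- the covariance of the initial state -/
  covInit : Mat p
  /-- the covariance of the noise -/
  covNoise : Mat p
  /-- the senders' cost matrices on the state: sender, stage -/
  Q : Fin m → ℕ → Matrix (Fin q) (Fin p) ℝ
  /-- the senders' cost matrices on the action: sender, stage -/
  R : Fin m → ℕ → Matrix (Fin q) (Fin t) ℝ
  /-- the receiver's cost matrices on the state -/
  Qr : ℕ → Matrix (Fin q) (Fin p) ℝ
  /-- the receiver's cost matrices on the action -/
  Rr : ℕ → Matrix (Fin q) (Fin t) ℝ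
  covInit_psd : covInit.PosSemidef
  covNoise_psd : covNoise.PosSemidef
  Rr_invertible : ∀ k ∈ Finset.Icc 1 n, IsUnit ((Rr k)ᵀ * Rr k)

variable {m p t q : ℕ}

namespace Game

/-- The covariance of the state, by the Lyapunov recursion. -/
def stateCov (G : Game m p t q) : ℕ → Mat p
  | 0 => G.covInit
  | k + 1 => G.A * G.stateCov k * G.Aᵀ + G.covNoise

/-- The matrix `R_i (R_rᵀ R_r)⁻¹ R_rᵀ Q_r` of stage `k`: when the receiver best responds to its
estimate `x̂` of the state, the term `R_i u` in the cost of sender `i` is `-(gain) x̂`. -/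
def gain (G : Game m p t q) (i : Fin m) (k : ℕ) : Matrix (Fin q) (Fin p) ℝ :=
  G.R i k * ((G.Rr k)ᵀ * G.Rr k)⁻¹ * (G.Rr k)ᵀ * G.Qr k

/-- The matrix of sender `i`'s stage cost as a linear function of the posterior covariance. -/
def V (G : Game m p t q) (i : Fin m) (k : ℕ) : Mat p :=
  (G.gain i k)ᵀ * G.gain i k - (G.gain i k)ᵀ * G.Q i k - (G.Q i k)ᵀ * G.gain i k

/-- Given posterior covariances `S`, the matrix `Σ_{k+1} - A S_k Aᵀ` of stage `k + 1`. -/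
def innovCov (G : Game m p t q) (S : ℕ → Mat p) (k : ℕ) : Mat p :=
  G.stateCov (k + 1) - G.A * S k * G.Aᵀ

end Game

/-! ### Stable posteriors -/

/-- The covariance `S` is a stable posterior for a sender with matrix `V` and prior covariance
`Sx`: it minimizes `Tr(V T)` among the `T` with `S ≤ T ≤ Sx`. -/
def IsStable (Sx V S : Mat p) : Prop :=
  0 ≤ S ∧ S ≤ Sx ∧ ∀ T : Mat p, S ≤ T → T ≤ Sx → (V * S).trace ≤ (V * T).trace

/-- `S 1, …, S n` are stable posteriors of the dynamic game, with corresponding (orthogonal)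
projection matrices `P 1, …, P n`. -/
structure IsStablePosteriorSeq (G : Game m p t q) (S P : ℕ → Mat p) : Prop where
  zero : S 0 = 0
  proj : ∀ k ∈ Finset.Icc 1 G.n, (P k)ᵀ = P k ∧ P k * P k = P k
  recursion : ∀ k < G.n, S (k + 1) = G.A * S k * G.Aᵀ
    + CFC.sqrt (G.innovCov S k) * P (k + 1) * CFC.sqrt (G.innovCov S k)
  stable : ∀ k ∈ Finset.Icc 1 G.n, ∀ i, IsStable (G.stateCov k) (G.V i k) (S k)

/-! ### The greedy sequential algorithm -/

/-- The nuclear norm (the sum of the singular values) of a real square matrix. -/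
def nuclearNorm (M : Mat p) : ℝ := (CFC.sqrt (Mᵀ * M)).trace

/-- `T` is an outcome of the step of a sender with matrix `V`, started from `S`: it minimizes
`Tr(V T)` over `S ≤ T ≤ Sx` and, among the minimizers, has the least normalized nuclear norm. -/
def IsStep (Sx V S T : Mat p) : Prop :=
  S ≤ T ∧ T ≤ Sx ∧ (∀ T', S ≤ T' → T' ≤ Sx → (V * T).trace ≤ (V * T').trace) ∧
    ∀ T', S ≤ T' → T' ≤ Sx → (V * T').trace ≤ (V * T).trace →
      nuclearNorm ((CFC.sqrt Sx)⁻¹ * T * (CFC.sqrt Sx)⁻¹)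
        ≤ nuclearNorm ((CFC.sqrt Sx)⁻¹ * T' * (CFC.sqrt Sx)⁻¹)

/-- `S` is an outcome of the single-stage algorithm with prior covariance `Sx`, in which the
senders with matrices `V i` make one step each, in the order `o`, started from `0`. -/
def IsStageOutput (Sx : Mat p) (V : Fin m → Mat p) (o : Equiv.Perm (Fin m)) (S : Mat p) : Prop :=
  ∃ T : Fin (m + 1) → Mat p, T 0 = 0 ∧
    (∀ j : Fin m, IsStep Sx (V (o j)) (T j.castSucc) (T j.succ)) ∧ T (Fin.last m) = S

/-- `S` is an outcome of the multistage algorithm, which at each stage runs the single-stage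
algorithm on the part of the state that the past signals leave unexplained. -/
def IsGreedyOutput (G : Game m p t q) (o : Equiv.Perm (Fin m)) (S : ℕ → Mat p) : Prop :=
  S 0 = 0 ∧ ∀ k < G.n, IsStageOutput (G.innovCov S k) (fun i => G.V i (k + 1)) o
    (S (k + 1) - G.A * S k * G.Aᵀ)

/-! ### The state process, policies and costs -/

variable {Ω : Type*} [MeasurableSpace Ω]

/-- `x` is the Gaussian Markov state process driven by the noise `w`, up to time `n`. -/
structure IsStateProcess (G : Game m p t q) (μ : Measure Ω) (x w : ℕ → Ω → Vec p) : Prop where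
  measurable_init : Measurable (x 0)
  measurable_noise : ∀ k < G.n, Measurable (w k)
  law_init : HasLaw (x 0) (multivariateGaussian 0 G.covInit) μ
  law_noise : ∀ k < G.n, HasLaw (w k) (multivariateGaussian 0 G.covNoise) μ
  indep : iIndepFun (Fin.cons (x 0) (fun k : Fin G.n => w k) : Fin (G.n + 1) → Ω → Vec p) μ
  dynamics : ∀ k < G.n, ∀ ω, x (k + 1) ω = Matrix.toEuclideanLin G.A (x k ω) + w k ω

/-- A sender's policy: at each stage `k`, a Borel function of the states `x_1, …, x_k`. -/
structure SenderPolicy (p : ℕ) where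
  toFun : (k : ℕ) → (Finset.Icc 1 k → Vec p) → Vec p
  measurable : ∀ k, Measurable (toFun k)

/-- The receiver's policy: at each stage `k`, a Borel function of all the signals of the stages
`1, …, k`. -/
structure ReceiverPolicy (m p t : ℕ) where
  toFun : (k : ℕ) → (Fin m → Finset.Icc 1 k → Vec p) → Vec t
  measurable : ∀ k, Measurable (toFun k)

/-- A policy for each sender. -/
abbrev Profile (m p : ℕ) := Fin m → SenderPolicy p

/-- The signal of a sender at stage `k`. -/
def signal (η : SenderPolicy p) (x : ℕ → Ω → Vec p) (k : ℕ) (ω : Ω) : Vec p :=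
  η.toFun k (fun j => x j ω)

/-- The receiver's information at stage `k`: all the senders' signals of the stages `1, …, k`. -/
def info (η : Profile m p) (x : ℕ → Ω → Vec p) (k : ℕ) (ω : Ω) : Fin m → Finset.Icc 1 k → Vec p :=
  fun i j => signal (η i) x j ω

/-- The receiver's action at stage `k`. -/
def action (η : Profile m p) (γ : ReceiverPolicy m p t) (x : ℕ → Ω → Vec p) (k : ℕ) (ω : Ω) :
    Vec t :=
  γ.toFun k (info η x k ω)

/-- The expected cost `E[∑_{k ≤ K} ‖Q_k x_k + R_k u_k‖²]` of the first `K` stages, possibly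
infinite. -/
def cost (μ : Measure Ω) (x : ℕ → Ω → Vec p) (Q : ℕ → Matrix (Fin q) (Fin p) ℝ)
    (R : ℕ → Matrix (Fin q) (Fin t) ℝ) (K : ℕ) (η : Profile m p) (γ : ReceiverPolicy m p t) :
    ℝ≥0∞ :=
  ∫⁻ ω, ∑ k ∈ Finset.Icc 1 K, ENNReal.ofReal
    (‖Matrix.toEuclideanLin (Q k) (x k ω) + Matrix.toEuclideanLin (R k) (action η γ x k ω)‖ ^ 2) ∂μ

/-- The receiver's estimate `E[x_k | signals up to stage k]`. -/
def estimate (μ : Measure Ω) (x : ℕ → Ω → Vec p) (η : Profile m p) (k : ℕ) : Ω → Vec p :=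
  μ[x k | MeasurableSpace.comap (info η x k) inferInstance]

/-- The posterior covariance `E[x̂_k x̂_kᵀ]`. -/
def posteriorCov (μ : Measure Ω) (x : ℕ → Ω → Vec p) (η : Profile m p) (k : ℕ) : Mat p :=
  Matrix.of fun a b => ∫ ω, estimate μ x η k ω a * estimate μ x η k ω b ∂μ

/-- `γ` is a best response of the receiver to the announced policies `η`, at every horizon. -/
def IsBestResponse (G : Game m p t q) (μ : Measure Ω) (x : ℕ → Ω → Vec p)
    (η : Profile m p) (γ : ReceiverPolicy m p t) : Prop :=
  ∀ K ∈ Finset.Icc 1 G.n, ∀ γ' : ReceiverPolicy m p t,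
    cost μ x G.Qr G.Rr K η γ ≤ cost μ x G.Qr G.Rr K η γ'

/-- `(η, γ)` is a multistage hierarchical Nash equilibrium: the receiver's strategy `γ` reacts to
every profile by a best response, and at no horizon does a sender gain by a unilateral deviation,
which may change its policy at any set of stages and to which the receiver reacts. -/
structure IsMultistageNash (G : Game m p t q) (μ : Measure Ω) (x : ℕ → Ω → Vec p)
    (η : Profile m p) (γ : Profile m p → ReceiverPolicy m p t) : Prop where
  receiver : ∀ η', IsBestResponse G μ x η' (γ η')
  sender : ∀ K ∈ Finset.Icc 1 G.n, ∀ (i : Fin m) (ηi : SenderPolicy p),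
    cost μ x (G.Q i) (G.R i) K η (γ η)
      ≤ cost μ x (G.Q i) (G.R i) K (Function.update η i ηi) (γ (Function.update η i ηi))

/-- The memoryless linear policy that sends `(L k)ᵀ x_k` at stage `k`. -/
def linearPolicy (L : ℕ → Mat p) : SenderPolicy p where
  toFun k xs := if h : k ∈ Finset.Icc 1 k then Matrix.toEuclideanLin (L k)ᵀ (xs ⟨k, h⟩) else 0
  measurable k := by
    by_cases h : k ∈ Finset.Icc 1 k
    · simp only [h, dite_true]
      exact (LinearMap.continuous_of_finiteDimensional _).measurable.comp (measurable_pi_apply _)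
    · simp only [h, dite_false]
      exact measurable_const

end Disclosure

end

/-! Actions do not influence the state, so the receiver's problem splits into one least-squares
problem per stage. Since `Rᵣᵀ Rᵣ` is invertible, the optimum is unique almost surely
(`action_ae_eq_bestAction`), so the choice of reaction map is immaterial. Each stage then costs a
sender a constant plus `Tr(V S)`, with `S` the posterior covariance of that stage
(`cost_of_isBestResponse`).

When at least two senders send identical signals, a single deviator can add information but not
remove any. Whatever it does, linear or not, the new posterior covariance lies between `S` and the
state covariance (`posteriorCov_mono`, `posteriorCov_le_stateCov`). Stability says that nothing in
this interval is cheaper, so no stage improves, and hence no horizon does.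

The stable posteriors are attained by a linear filter with gain `H = D^{1/2} P D^{-1/2}`. Its second
moment and its mixed moment with the state both equal `S` (`crossMoment_stateFilter`). Its error is
uncorrelated with all signals sent so far (`crossMoment_stateFilter_error`), hence independent of
them by joint Gaussianity, while the filter is a function of these signals. So the filter is the
conditional expectation.

For the greedy algorithm, the coordinates `N = D^{-1/2} T D^{-1/2}` turn the constraint into `P ≤ N
≤ 1` and the nuclear norm into the trace. If `N` is a minimizer, both `N + (N - N²)` and `N² = N -
(N - N²)` are feasible. Optimality against the first makes the second a minimizer too, and least
trace forces `N² = N` (`isIdempotent_of_least_trace`). Later steps only raise the lower bound, so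
stability for the earlier senders survives. -/

namespace Disclosure

/-! ### Loewner order, projections and the greedy algorithm -/

section GreedyAlgorithm

variable {m p t q : ℕ}

theorem Mat.nonneg_transpose {M : Mat p} (h : 0 ≤ M) : Mᵀ = M := by
  have := (Matrix.nonneg_iff_posSemidef.1 h).isHermitian
  simpa [Matrix.IsHermitian] using this

theorem Mat.conj_le {A B : Mat p} (h : A ≤ B) (C : Mat p) : C * A * Cᵀ ≤ C * B * Cᵀ := by
  have := star_right_conjugate_le_conjugate h C
  simpa [Matrix.star_eq_conjTranspose] using this

theorem Mat.conj_nonneg {A : Mat p} (h : 0 ≤ A) (C : Mat p) : 0 ≤ C * A * Cᵀ := by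
  simpa using Mat.conj_le h C

theorem Mat.mul_transpose_nonneg (A : Mat p) : 0 ≤ A * Aᵀ := by
  simpa using Mat.conj_nonneg (zero_le_one : (0 : Mat p) ≤ 1) A

theorem Mat.trace_mono {A B : Mat p} (h : A ≤ B) : A.trace ≤ B.trace := by
  have := (Matrix.le_iff.1 h).trace_nonneg
  rw [Matrix.trace_sub] at this
  linarith

theorem Mat.sqrt_transpose (M : Mat p) : (CFC.sqrt M)ᵀ = CFC.sqrt M :=
  Mat.nonneg_transpose (CFC.sqrt_nonneg M)

theorem Mat.sqrt_inv_transpose (M : Mat p) : ((CFC.sqrt M)⁻¹)ᵀ = (CFC.sqrt M)⁻¹ := by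
  rw [Matrix.transpose_nonsing_inv, Mat.sqrt_transpose]

theorem Mat.sqrt_mul_sqrt {M : Mat p} (h : M.PosDef) : CFC.sqrt M * CFC.sqrt M = M :=
  CFC.sqrt_mul_sqrt_self M h.posSemidef.nonneg

theorem Mat.isUnit_det_sqrt {M : Mat p} (h : M.PosDef) : IsUnit (CFC.sqrt M).det := by
  have h1 : IsUnit (CFC.sqrt M * CFC.sqrt M).det := by
    rw [Mat.sqrt_mul_sqrt h]
    exact (Matrix.isUnit_iff_isUnit_det _).1 h.isUnit
  rw [Matrix.det_mul] at h1
  exact isUnit_of_mul_isUnit_left h1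

theorem Mat.sqrt_mul_inv {M : Mat p} (h : M.PosDef) : CFC.sqrt M * (CFC.sqrt M)⁻¹ = 1 :=
  Matrix.mul_nonsing_inv _ (Mat.isUnit_det_sqrt h)

theorem Mat.inv_mul_sqrt {M : Mat p} (h : M.PosDef) : (CFC.sqrt M)⁻¹ * CFC.sqrt M = 1 :=
  Matrix.nonsing_inv_mul _ (Mat.isUnit_det_sqrt h)

theorem Mat.mul_inv_sqrt {M : Mat p} (h : M.PosDef) : M * (CFC.sqrt M)⁻¹ = CFC.sqrt M := by
  nth_rewrite 1 [← Mat.sqrt_mul_sqrt h]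
  rw [mul_assoc, Mat.sqrt_mul_inv h, mul_one]

theorem nuclearNorm_of_nonneg {M : Mat p} (h : 0 ≤ M) : nuclearNorm M = M.trace := by
  rw [nuclearNorm, Mat.nonneg_transpose h, CFC.sqrt_mul_self M h]

/-- A projection `P` absorbs every matrix between itself and the identity. -/
theorem proj_mul_eq_of_le {P N : Mat p} (hP : Pᵀ = P) (hPP : P * P = P) (h1 : P ≤ N)
    (h2 : N ≤ 1) : P * N = P := by
  have hN : 0 ≤ 1 - N := sub_nonneg.2 h2
  set B := CFC.sqrt (1 - N)
  have hB : B * B = 1 - N := CFC.sqrt_mul_sqrt_self _ hN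
  have hBt : Bᵀ = B := Mat.sqrt_transpose _
  -- Squeezed: conjugating `P ≤ N` by `P` bounds it above by `0`, conjugating `0 ≤ 1 - N` bounds it
  -- below.
  have h3 : P * (1 - N) * P = 0 := by
    refine le_antisymm ?_ (by simpa [hP] using Mat.conj_nonneg hN P)
    have := Mat.conj_le h1 P
    rw [hP, hPP, hPP] at this
    rw [mul_sub, sub_mul, mul_one, hPP]
    exact sub_nonpos.2 this
  have h4 : B * P = 0 := by
    rw [← Matrix.conjTranspose_mul_self_eq_zero (A := B * P)]
    rw [Matrix.conjTranspose_eq_transpose_of_trivial, Matrix.transpose_mul, hP, hBt,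
      ← mul_assoc, mul_assoc P B B, hB, h3]
  have h5 : P * B = 0 := by
    have := congrArg Matrix.transpose h4
    simpa [Matrix.transpose_mul, hP, hBt] using this
  have h6 : P * (1 - N) = 0 := by rw [← hB, ← mul_assoc, h5, zero_mul]
  rw [mul_sub, mul_one] at h6
  exact (sub_eq_zero.1 h6).symm

/-- Among the minimizers of a linear functional above a projection and below the identity, one of
least trace is a projection. -/
theorem isIdempotent_of_least_trace {W P N : Mat p} (hP : Pᵀ = P) (hPP : P * P = P) (h1 : P ≤ N)
    (h2 : N ≤ 1) (hmin : ∀ N', P ≤ N' → N' ≤ 1 → (W * N).trace ≤ (W * N').trace)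
    (hleast : ∀ N', P ≤ N' → N' ≤ 1 → (W * N').trace ≤ (W * N).trace → N.trace ≤ N'.trace) :
    N * N = N := by
  have hP0 : 0 ≤ P := by
    have := Mat.mul_transpose_nonneg P
    rwa [hP, hPP] at this
  have hN0 : 0 ≤ N := hP0.trans h1
  have hNt := Mat.nonneg_transpose hN0
  have hPN := proj_mul_eq_of_le hP hPP h1 h2
  have hNP : N * P = P := by
    have := congrArg Matrix.transpose hPN
    simpa [Matrix.transpose_mul, hP, hNt] using this
  -- `N - N² = N (1 - N) N + (1 - N) N (1 - N)`, a sum of two nonnegative terms.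
  have hle : N * N ≤ N := by
    have e1 := Mat.conj_nonneg (sub_nonneg.2 h2) N
    have e2 := Mat.conj_nonneg hN0 (1 - N)
    rw [Matrix.transpose_sub, Matrix.transpose_one, hNt] at e2
    rw [hNt] at e1
    rw [← sub_nonneg]
    convert add_nonneg e1 e2 using 1
    noncomm_ring
  -- `P N = N P = P` gives `(N - P)² = N² - P`.
  have hsq : P ≤ N * N := by
    have := Mat.mul_transpose_nonneg (N - P)
    rw [Matrix.transpose_sub, hP, hNt, mul_sub, sub_mul, sub_mul, hPN, hNP, hPP, sub_self,
      sub_zero] at this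
    exact sub_nonneg.1 this
  have hd1 : P ≤ N + (N - N * N) := h1.trans (le_add_of_nonneg_right (sub_nonneg.2 hle))
  -- The gap is the square `(1 - N)²`.
  have hd2 : N + (N - N * N) ≤ 1 := by
    have := Mat.mul_transpose_nonneg (1 - N)
    rw [Matrix.transpose_sub, Matrix.transpose_one, hNt] at this
    rw [← sub_nonneg]
    convert this using 1
    noncomm_ring
  -- This yields `Tr(W (N - N²)) ≥ 0`, so `N²` is a minimizer as well and `Tr N ≤ Tr N²`. The
  -- nonnegative matrix `N - N²` then has trace zero.
  have m1 := hmin _ hd1 hd2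
  rw [mul_add, mul_sub, Matrix.trace_add, Matrix.trace_sub] at m1
  have m2 := hleast _ hsq (hle.trans h2) (by linarith)
  have m3 := Mat.trace_mono hle
  have m4 : (N - N * N).trace = 0 := by rw [Matrix.trace_sub]; linarith
  have := ((Matrix.le_iff.1 hle).trace_eq_zero_iff).1 m4
  exact (sub_eq_zero.1 this).symm

/-- A step started from the image of a projection ends in the image of a projection. -/
theorem IsStep.isIdempotent {Sx V S T : Mat p} (hSx : Sx.PosDef) (h : IsStep Sx V S T)
    (hSt : Sᵀ = S)
    (hS : (CFC.sqrt Sx)⁻¹ * S * (CFC.sqrt Sx)⁻¹ * ((CFC.sqrt Sx)⁻¹ * S * (CFC.sqrt Sx)⁻¹)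
      = (CFC.sqrt Sx)⁻¹ * S * (CFC.sqrt Sx)⁻¹) :
    (CFC.sqrt Sx)⁻¹ * T * (CFC.sqrt Sx)⁻¹ * ((CFC.sqrt Sx)⁻¹ * T * (CFC.sqrt Sx)⁻¹)
      = (CFC.sqrt Sx)⁻¹ * T * (CFC.sqrt Sx)⁻¹ := by
  obtain ⟨h1, h2, h3, h4⟩ := h
  set B := CFC.sqrt Sx
  have hB : Bᵀ = B := Mat.sqrt_transpose _
  have hC : (B⁻¹)ᵀ = B⁻¹ := Mat.sqrt_inv_transpose _
  have hBC : B * B⁻¹ = 1 := Mat.sqrt_mul_inv hSx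
  have hCB : B⁻¹ * B = 1 := Mat.inv_mul_sqrt hSx
  have hBB : B * B = Sx := Mat.sqrt_mul_sqrt hSx
  have hCSC : B⁻¹ * Sx * B⁻¹ = 1 := by rw [← hBB, ← mul_assoc, hCB, one_mul, hBC]
  -- `T ↦ B⁻¹ T B⁻¹` is an order isomorphism from the interval `[S, Sx]` to `[B⁻¹ S B⁻¹, 1]`; the
  -- functional `V` becomes `B V B`.
  have up {X Y : Mat p} (hXY : X ≤ Y) : B⁻¹ * X * B⁻¹ ≤ B⁻¹ * Y * B⁻¹ := by
    simpa [hC] using Mat.conj_le hXY B⁻¹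
  have down {X Y : Mat p} (hXY : X ≤ Y) : B * X * B ≤ B * Y * B := by
    simpa [hB] using Mat.conj_le hXY B
  have inv1 (X : Mat p) : B * (B⁻¹ * X * B⁻¹) * B = X := by
    rw [mul_assoc, mul_assoc (B⁻¹ * X), hCB, mul_one, ← mul_assoc, hBC, one_mul]
  have inv2 (X : Mat p) : B⁻¹ * (B * X * B) * B⁻¹ = X := by
    rw [mul_assoc, mul_assoc (B * X), hBC, mul_one, ← mul_assoc, hCB, one_mul]
  have tr (X : Mat p) : (B * V * B * X).trace = (V * (B * X * B)).trace := by
    rw [mul_assoc B V, mul_assoc B, Matrix.trace_mul_comm]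
    simp only [mul_assoc]
  have hPt : (B⁻¹ * S * B⁻¹)ᵀ = B⁻¹ * S * B⁻¹ := by
    rw [Matrix.transpose_mul, Matrix.transpose_mul, hC, hSt, mul_assoc]
  have hP0 : 0 ≤ B⁻¹ * S * B⁻¹ := by
    have := Mat.mul_transpose_nonneg (B⁻¹ * S * B⁻¹)
    rwa [hPt, hS] at this
  have feas {N : Mat p} (a : B⁻¹ * S * B⁻¹ ≤ N) (b : N ≤ 1) : S ≤ B * N * B ∧ B * N * B ≤ Sx := by
    have a' := down a
    have b' := down b
    rw [inv1] at a'
    rw [mul_one, hBB] at b'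
    exact ⟨a', b'⟩
  refine isIdempotent_of_least_trace (W := B * V * B) hPt hS (up h1) ?_ ?_ ?_
  · simpa [hCSC] using up h2
  · intro N a b
    rw [tr, tr, inv1]
    exact h3 _ (feas a b).1 (feas a b).2
  · intro N a b c
    rw [tr, tr, inv1] at c
    have := h4 _ (feas a b).1 (feas a b).2 c
    rwa [inv2, nuclearNorm_of_nonneg (hP0.trans a),
      nuclearNorm_of_nonneg (hP0.trans (up h1))] at this

/-- An output of the single-stage algorithm is nonnegative and below the prior covariance, is the
image of a projection, and is stable. -/
theorem IsStageOutput.spec {Sx S : Mat p} {V : Fin m → Mat p} {o : Equiv.Perm (Fin m)}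
    (hSx : Sx.PosDef) (h : IsStageOutput Sx V o S) :
    (0 ≤ S ∧ S ≤ Sx) ∧
    (CFC.sqrt Sx)⁻¹ * S * (CFC.sqrt Sx)⁻¹ * ((CFC.sqrt Sx)⁻¹ * S * (CFC.sqrt Sx)⁻¹)
      = (CFC.sqrt Sx)⁻¹ * S * (CFC.sqrt Sx)⁻¹ ∧
    ∀ i, ∀ T : Mat p, S ≤ T → T ≤ Sx → (V i * S).trace ≤ (V i * T).trace := by
  obtain ⟨T, h0, hstep, rfl⟩ := h
  have mono : Monotone T := Fin.monotone_iff_le_succ.2 fun j => (hstep j).1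
  have hnn (j) : 0 ≤ T j := h0 ▸ mono (Fin.zero_le j)
  have hle (j) : T j ≤ Sx := by
    induction j using Fin.cases with
    | zero => rw [h0]; exact hSx.posSemidef.nonneg
    | succ j => exact (hstep j).2.1
  have hid (j) : (CFC.sqrt Sx)⁻¹ * T j * (CFC.sqrt Sx)⁻¹
      * ((CFC.sqrt Sx)⁻¹ * T j * (CFC.sqrt Sx)⁻¹) = (CFC.sqrt Sx)⁻¹ * T j * (CFC.sqrt Sx)⁻¹ := by
    induction j using Fin.induction with
    | zero => simp [h0]
    | succ j ih => exact (hstep j).isIdempotent hSx (Mat.nonneg_transpose (hnn _)) ih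
  refine ⟨⟨hnn _, hle _⟩, hid _, fun i T' h1 h2 => ?_⟩
  have hs := hstep (o.symm i)
  rw [o.apply_symm_apply] at hs
  set j := o.symm i
  have hj : T j.succ ≤ T (Fin.last m) := mono (Fin.le_last _)
  -- A competitor `T'` above the final output is translated down to one above the output of sender
  -- `i`'s own step, where that step was optimal. The translation stays below `Sx` because the
  -- outputs increase.
  have := hs.2.2.1 (T j.succ + (T' - T (Fin.last m)))
    (hs.1.trans (le_add_of_nonneg_right (sub_nonneg.2 h1)))
    (by
      have : T j.succ + (T' - T (Fin.last m)) = T' - (T (Fin.last m) - T j.succ) := by abel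
      rw [this]
      exact (sub_le_self _ (sub_nonneg.2 hj)).trans h2)
  rw [mul_add, mul_sub, Matrix.trace_add, Matrix.trace_sub] at this
  linarith

/-- The outcomes of the greedy algorithm are sequences of stable posteriors. -/
theorem IsGreedyOutput.exists_isStablePosteriorSeq {G : Game m p t q} {o : Equiv.Perm (Fin m)}
    {S : ℕ → Mat p} (h : IsGreedyOutput G o S) (hD : ∀ k < G.n, (G.innovCov S k).PosDef) :
    ∃ P : ℕ → Mat p, IsStablePosteriorSeq G S P := by
  obtain ⟨h0, hst⟩ := h
  have hnn : ∀ k ≤ G.n, 0 ≤ S k := by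
    intro k
    induction k with
    | zero => intro _; rw [h0]
    | succ k ih =>
      intro hk
      have h1 := ((hst k hk).spec (hD k hk)).1.1
      have h2 := Mat.conj_nonneg (ih (by omega)) G.A
      exact h2.trans (sub_nonneg.1 h1)
  have hid (k) (hk : k < G.n) := ((hst k hk).spec (hD k hk)).2.1
  have hstab (k) (hk : k < G.n) := ((hst k hk).spec (hD k hk)).2.2
  -- The recursion solved for `P k`. Only `k ≥ 1` matters, so the truncated `k - 1` at `k = 0` is
  -- harmless.
  refine ⟨fun k => (CFC.sqrt (G.innovCov S (k - 1)))⁻¹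
    * (S k - G.A * S (k - 1) * G.Aᵀ) * (CFC.sqrt (G.innovCov S (k - 1)))⁻¹, h0, ?_, ?_, ?_⟩
  · intro k hk
    obtain ⟨k, rfl⟩ : ∃ l, k = l + 1 := ⟨k - 1, by rw [Finset.mem_Icc] at hk; omega⟩
    rw [Finset.mem_Icc] at hk
    have hk' : k < G.n := by omega
    simp only [Nat.add_sub_cancel]
    refine ⟨?_, hid k hk'⟩
    rw [Matrix.transpose_mul, Matrix.transpose_mul, Mat.sqrt_inv_transpose,
      Mat.nonneg_transpose ((hst k hk').spec (hD k hk')).1.1]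
    exact (mul_assoc _ _ _).symm
  · intro k hk
    simp only [Nat.add_sub_cancel]
    have h1 := Mat.sqrt_mul_inv (hD k hk)
    have h2 := Mat.inv_mul_sqrt (hD k hk)
    rw [mul_assoc (CFC.sqrt _), mul_assoc ((CFC.sqrt _)⁻¹ * _), h2, mul_one, ← mul_assoc, h1,
      one_mul]
    abel
  · intro k hk i
    obtain ⟨k, rfl⟩ : ∃ l, k = l + 1 := ⟨k - 1, by rw [Finset.mem_Icc] at hk; omega⟩
    rw [Finset.mem_Icc] at hk
    have hk' : k < G.n := by omega
    refine ⟨hnn _ hk.2, ?_, fun T h1 h2 => ?_⟩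
    · have := ((hst k hk').spec (hD k hk')).1.2
      rw [Game.innovCov] at this
      exact sub_le_sub_iff_right _ |>.1 this
    -- Stability is invariant under translation by `A Sₖ Aᵀ`, which takes the state covariance to
    -- the innovation covariance.
    · have := hstab k hk' i (T - G.A * S k * G.Aᵀ) (sub_le_sub_right h1 _) (sub_le_sub_right h2 _)
      rw [mul_sub, mul_sub, Matrix.trace_sub, Matrix.trace_sub] at this
      linarith

end GreedyAlgorithm

/-! ### Calculus of second-moment matrices -/

section CrossMoment

variable {Ω : Type*} {mΩ : MeasurableSpace Ω} {μ : Measure Ω} {a b c : ℕ}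

/-- The matrix `E[X Yᵀ]` of the mixed second moments of two random vectors. -/
noncomputable def crossMoment (μ : Measure Ω) (X : Ω → Vec a) (Y : Ω → Vec b) :
    Matrix (Fin a) (Fin b) ℝ :=
  Matrix.of fun i j => ∫ ω, X ω i * Y ω j ∂μ

theorem crossMoment_apply (X : Ω → Vec a) (Y : Ω → Vec b) (i : Fin a) (j : Fin b) :
    crossMoment μ X Y i j = ∫ ω, X ω i * Y ω j ∂μ := rfl

theorem integrable_coord_mul {X : Ω → Vec a} {Y : Ω → Vec b} (hX : MemLp X 2 μ)
    (hY : MemLp Y 2 μ) (i : Fin a) (j : Fin b) : Integrable (fun ω => X ω i * Y ω j) μ :=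
  (hX.eval_piLp i).integrable_mul (hY.eval_piLp j)

theorem crossMoment_congr {X X' : Ω → Vec a} {Y Y' : Ω → Vec b} (hX : X =ᵐ[μ] X')
    (hY : Y =ᵐ[μ] Y') : crossMoment μ X Y = crossMoment μ X' Y' := by
  ext i j
  refine integral_congr_ae ?_
  filter_upwards [hX, hY] with ω h1 h2
  rw [h1, h2]

theorem crossMoment_transpose (X : Ω → Vec a) (Y : Ω → Vec b) :
    (crossMoment μ X Y)ᵀ = crossMoment μ Y X := by
  ext i j
  simp only [Matrix.transpose_apply, crossMoment_apply, mul_comm]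

theorem crossMoment_zero_left (Y : Ω → Vec b) :
    crossMoment μ (fun _ => (0 : Vec a)) Y = 0 := by
  ext i j
  simp [crossMoment_apply]

theorem crossMoment_add_left {X X' : Ω → Vec a} {Y : Ω → Vec b} (hX : MemLp X 2 μ)
    (hX' : MemLp X' 2 μ) (hY : MemLp Y 2 μ) :
    crossMoment μ (fun ω => X ω + X' ω) Y = crossMoment μ X Y + crossMoment μ X' Y := by
  ext i j
  simp only [Matrix.add_apply, crossMoment_apply, PiLp.add_apply, add_mul]
  exact integral_add (integrable_coord_mul hX hY i j) (integrable_coord_mul hX' hY i j)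

theorem crossMoment_sub_left {X X' : Ω → Vec a} {Y : Ω → Vec b} (hX : MemLp X 2 μ)
    (hX' : MemLp X' 2 μ) (hY : MemLp Y 2 μ) :
    crossMoment μ (fun ω => X ω - X' ω) Y = crossMoment μ X Y - crossMoment μ X' Y := by
  ext i j
  simp only [Matrix.sub_apply, crossMoment_apply, PiLp.sub_apply, sub_mul]
  exact integral_sub (integrable_coord_mul hX hY i j) (integrable_coord_mul hX' hY i j)

theorem crossMoment_mul_left {X : Ω → Vec a} {Y : Ω → Vec b} (hX : MemLp X 2 μ)
    (hY : MemLp Y 2 μ) (M : Matrix (Fin c) (Fin a) ℝ) :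
    crossMoment μ (fun ω => Matrix.toEuclideanLin M (X ω)) Y = M * crossMoment μ X Y := by
  ext i j
  simp only [Matrix.mul_apply, crossMoment_apply, Matrix.ofLp_toLpLin,
    Matrix.toLin'_apply, Matrix.mulVec, dotProduct, Finset.sum_mul]
  rw [integral_finsetSum]
  · simp only [mul_assoc, integral_const_mul]
  · intro l _
    simpa only [mul_assoc] using (integrable_coord_mul hX hY l j).const_mul (M i l)

theorem crossMoment_add_right {X : Ω → Vec a} {Y Y' : Ω → Vec b} (hX : MemLp X 2 μ)
    (hY : MemLp Y 2 μ) (hY' : MemLp Y' 2 μ) :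
    crossMoment μ X (fun ω => Y ω + Y' ω) = crossMoment μ X Y + crossMoment μ X Y' := by
  rw [← crossMoment_transpose, crossMoment_add_left hY hY' hX, Matrix.transpose_add,
    crossMoment_transpose, crossMoment_transpose]

theorem crossMoment_sub_right {X : Ω → Vec a} {Y Y' : Ω → Vec b} (hX : MemLp X 2 μ)
    (hY : MemLp Y 2 μ) (hY' : MemLp Y' 2 μ) :
    crossMoment μ X (fun ω => Y ω - Y' ω) = crossMoment μ X Y - crossMoment μ X Y' := by
  rw [← crossMoment_transpose, crossMoment_sub_left hY hY' hX, Matrix.transpose_sub,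
    crossMoment_transpose, crossMoment_transpose]

theorem crossMoment_mul_right {X : Ω → Vec a} {Y : Ω → Vec b} (hX : MemLp X 2 μ)
    (hY : MemLp Y 2 μ) (M : Matrix (Fin c) (Fin b) ℝ) :
    crossMoment μ X (fun ω => Matrix.toEuclideanLin M (Y ω)) = crossMoment μ X Y * Mᵀ := by
  rw [← crossMoment_transpose, crossMoment_mul_left hY hX, Matrix.transpose_mul,
    crossMoment_transpose]

theorem memLp_toEuclideanLin {X : Ω → Vec a} (hX : MemLp X 2 μ) (M : Matrix (Fin c) (Fin a) ℝ) :
    MemLp (fun ω => Matrix.toEuclideanLin M (X ω)) 2 μ :=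
  (LinearMap.toContinuousLinearMap (Matrix.toEuclideanLin M)).comp_memLp' hX

theorem memLp_add {X Y : Ω → Vec a} (hX : MemLp X 2 μ) (hY : MemLp Y 2 μ) :
    MemLp (fun ω => X ω + Y ω) 2 μ := hX.add hY

theorem memLp_sub {X Y : Ω → Vec a} (hX : MemLp X 2 μ) (hY : MemLp Y 2 μ) :
    MemLp (fun ω => X ω - Y ω) 2 μ := hX.sub hY

theorem toEuclideanLin_mul_apply (M : Matrix (Fin c) (Fin a) ℝ) (N : Matrix (Fin a) (Fin b) ℝ)
    (v : Vec b) : Matrix.toEuclideanLin (M * N) v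
      = Matrix.toEuclideanLin M (Matrix.toEuclideanLin N v) := by
  simp only [Matrix.toLpLin_apply, Matrix.mulVec_mulVec]

theorem toEuclideanLin_one_apply (v : Vec a) :
    Matrix.toEuclideanLin (1 : Matrix (Fin a) (Fin a) ℝ) v = v := by
  simp

theorem measurable_toEuclideanLin (M : Matrix (Fin c) (Fin a) ℝ) :
    Measurable fun v : Vec a => Matrix.toEuclideanLin M v :=
  (LinearMap.continuous_of_finiteDimensional _).measurable

theorem trace_crossMoment_self {X : Ω → Vec a} (hX : MemLp X 2 μ) :
    (crossMoment μ X X).trace = ∫ ω, ‖X ω‖ ^ 2 ∂μ := by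
  simp only [Matrix.trace, Matrix.diag_apply, crossMoment_apply, EuclideanSpace.real_norm_sq_eq]
  rw [integral_finsetSum]
  · simp only [sq]
  · intro i _
    simpa only [sq] using integrable_coord_mul hX hX i i

/-- The quadratic form at `v` is the second moment of the scalar `⟨v, X⟩`, obtained here by reading
`v` as a one-row matrix. -/
theorem crossMoment_self_nonneg {X : Ω → Vec a} (hX : MemLp X 2 μ) : 0 ≤ crossMoment μ X X := by
  rw [Matrix.nonneg_iff_posSemidef]
  refine Matrix.PosSemidef.of_dotProduct_mulVec_nonneg ?_ fun v => ?_
  · rw [Matrix.IsHermitian, Matrix.conjTranspose_eq_transpose_of_trivial, crossMoment_transpose]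
  · have key := crossMoment_mul_left hX (memLp_toEuclideanLin hX (Matrix.of fun _ : Fin 1 => v))
      (Matrix.of fun _ : Fin 1 => v)
    rw [crossMoment_mul_right hX hX] at key
    have h := congrArg (fun M : Matrix (Fin 1) (Fin 1) ℝ => M.trace) key
    simp only at h
    rw [trace_crossMoment_self (memLp_toEuclideanLin hX _)] at h
    have h0 : 0 ≤ ∫ ω, ‖Matrix.toEuclideanLin (Matrix.of fun _ : Fin 1 => v) (X ω)‖ ^ 2 ∂μ :=
      integral_nonneg fun _ => by positivity
    rw [h, ← Matrix.mul_assoc] at h0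
    rw [Matrix.dotProduct_mulVec]
    simpa [Matrix.trace, Matrix.mul_apply, Matrix.vecMul, dotProduct] using h0

theorem lintegral_norm_sq {X : Ω → Vec a} (hX : MemLp X 2 μ) :
    ∫⁻ ω, ENNReal.ofReal (‖X ω‖ ^ 2) ∂μ = ENNReal.ofReal (crossMoment μ X X).trace := by
  rw [trace_crossMoment_self hX, ofReal_integral_eq_lintegral_ofReal]
  · exact (memLp_two_iff_integrable_sq_norm hX.1).1 hX
  · exact Filter.Eventually.of_forall fun _ => by positivity

theorem memLp_two_of_lintegral_ne_top {X : Ω → Vec a} (hX : AEStronglyMeasurable X μ)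
    (h : ∫⁻ ω, ENNReal.ofReal (‖X ω‖ ^ 2) ∂μ ≠ ∞) : MemLp X 2 μ := by
  rw [memLp_two_iff_integrable_sq_norm hX]
  refine ⟨hX.norm.pow 2, ?_⟩
  rw [hasFiniteIntegral_iff_ofReal (Filter.Eventually.of_forall fun _ => by positivity)]
  exact h.lt_top

theorem ae_eq_zero_of_trace_crossMoment {X : Ω → Vec a} (hX : MemLp X 2 μ)
    (h : (crossMoment μ X X).trace ≤ 0) : ∀ᵐ ω ∂μ, X ω = 0 := by
  rw [trace_crossMoment_self hX] at h
  have h0 : ∫ ω, ‖X ω‖ ^ 2 ∂μ = 0 := le_antisymm h (integral_nonneg fun _ => by positivity)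
  rw [integral_eq_zero_iff_of_nonneg (fun _ => by positivity)
    ((memLp_two_iff_integrable_sq_norm hX.1).1 hX)] at h0
  filter_upwards [h0] with ω hω
  simpa using hω

end CrossMoment

/-! ### Conditional expectation and quadratic costs -/

section CondExp

variable {Ω : Type*} {mΩ : MeasurableSpace Ω} {μ : Measure Ω} {a b c : ℕ}

/-- The conditional expectation has the same mixed moments with the observable vectors as the
vector itself. -/
theorem crossMoment_condExp [IsProbabilityMeasure μ] {m' : MeasurableSpace Ω} (hm : m' ≤ mΩ)
    {X : Ω → Vec a} {Y : Ω → Vec b} (hX : MemLp X 2 μ) (hY : MemLp Y 2 μ)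
    (hYm : StronglyMeasurable[m'] Y) :
    crossMoment μ (μ[X | m']) Y = crossMoment μ X Y := by
  ext i j
  have h1 := ContinuousLinearMap.comp_condExp_comm (m := m') (hX.integrable one_le_two)
    (EuclideanSpace.proj i : Vec a →L[ℝ] ℝ)
  have hYj : StronglyMeasurable[m'] fun ω => Y ω j :=
    (EuclideanSpace.proj j : Vec b →L[ℝ] ℝ).continuous.comp_stronglyMeasurable hYm
  have h2 := condExp_mul_of_stronglyMeasurable_right (μ := μ) (f := fun ω => X ω i) hYj
    (integrable_coord_mul hX hY i j) ((hX.eval_piLp i).integrable one_le_two)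
  rw [crossMoment_apply, crossMoment_apply]
  calc ∫ ω, (μ[X | m']) ω i * Y ω j ∂μ
      = ∫ ω, (μ[(fun ω => X ω i) * (fun ω => Y ω j) | m']) ω ∂μ := by
        refine integral_congr_ae ?_
        filter_upwards [h1, h2] with ω e1 e2
        rw [e2, Pi.mul_apply]
        congr 1
    _ = _ := integral_condExp hm

/-- Pythagoras: the coarser estimate is observable for the finer information, so the difference of
the two moment matrices is the moment matrix of the difference of the estimates. -/
theorem crossMoment_condExp_le [IsProbabilityMeasure μ] {m₁ m₂ : MeasurableSpace Ω}
    (h12 : m₁ ≤ m₂) (hm : m₂ ≤ mΩ) {X : Ω → Vec a} (hX : MemLp X 2 μ) :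
    crossMoment μ (μ[X | m₁]) (μ[X | m₁]) ≤ crossMoment μ (μ[X | m₂]) (μ[X | m₂]) := by
  have hX1 : MemLp (μ[X | m₁]) 2 μ := hX.condExp one_le_two
  have hX2 : MemLp (μ[X | m₂]) 2 μ := hX.condExp one_le_two
  have e1 := crossMoment_condExp (h12.trans hm) hX hX1 stronglyMeasurable_condExp
  have e2 := crossMoment_condExp hm hX hX1 (stronglyMeasurable_condExp.mono h12)
  have e3 : crossMoment μ (μ[X | m₁]) (μ[X | m₂]) = crossMoment μ X (μ[X | m₁]) := by
    rw [← crossMoment_transpose, e2, ← e1, crossMoment_transpose]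
  have := crossMoment_self_nonneg (memLp_sub hX2 hX1)
  rw [crossMoment_sub_left hX2 hX1 (memLp_sub hX2 hX1), crossMoment_sub_right hX2 hX2 hX1,
    crossMoment_sub_right hX1 hX2 hX1, e2, e1, e3, sub_self, sub_zero, ← e1] at this
  exact sub_nonneg.1 this

theorem crossMoment_condExp_le_self [IsProbabilityMeasure μ] {m' : MeasurableSpace Ω}
    (hm : m' ≤ mΩ) {X : Ω → Vec a} (hX : MemLp X 2 μ) :
    crossMoment μ (μ[X | m']) (μ[X | m']) ≤ crossMoment μ X X := by
  have hX1 : MemLp (μ[X | m']) 2 μ := hX.condExp one_le_two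
  have e1 := crossMoment_condExp hm hX hX1 stronglyMeasurable_condExp
  have e2 : crossMoment μ (μ[X | m']) X = crossMoment μ X (μ[X | m']) := by
    rw [← crossMoment_transpose, ← e1, crossMoment_transpose]
  have := crossMoment_self_nonneg (memLp_sub hX hX1)
  rw [crossMoment_sub_left hX hX1 (memLp_sub hX hX1), crossMoment_sub_right hX hX hX1,
    crossMoment_sub_right hX1 hX hX1, e1, e2, sub_self, sub_zero, ← e1] at this
  exact sub_nonneg.1 this

/-- The expected quadratic cost of an action. -/
noncomputable def stageCost (μ : Measure Ω) (Q : Matrix (Fin c) (Fin a) ℝ)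
    (R : Matrix (Fin c) (Fin b) ℝ) (X : Ω → Vec a) (u : Ω → Vec b) : ℝ≥0∞ :=
  ∫⁻ ω, ENNReal.ofReal (‖Matrix.toEuclideanLin Q (X ω) + Matrix.toEuclideanLin R (u ω)‖ ^ 2) ∂μ

theorem stageCost_congr {Q : Matrix (Fin c) (Fin a) ℝ} {R : Matrix (Fin c) (Fin b) ℝ}
    {X : Ω → Vec a} {u u' : Ω → Vec b} (h : u =ᵐ[μ] u') :
    stageCost μ Q R X u = stageCost μ Q R X u' := by
  refine lintegral_congr_ae ?_
  filter_upwards [h] with ω hω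
  rw [hω]

/-- The action that minimizes the expected quadratic cost given the information `m'`. -/
noncomputable def optimalAction (μ : Measure Ω) (m' : MeasurableSpace Ω)
    (Q : Matrix (Fin c) (Fin a) ℝ) (R : Matrix (Fin c) (Fin b) ℝ) (X : Ω → Vec a) (ω : Ω) : Vec b :=
  -Matrix.toEuclideanLin ((Rᵀ * R)⁻¹ * Rᵀ * Q) ((μ[X | m']) ω)

theorem stronglyMeasurable_optimalAction {m' : MeasurableSpace Ω}
    {Q : Matrix (Fin c) (Fin a) ℝ} {R : Matrix (Fin c) (Fin b) ℝ} {X : Ω → Vec a} :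
    StronglyMeasurable[m'] (optimalAction μ m' Q R X) :=
  ((LinearMap.continuous_of_finiteDimensional _).comp_stronglyMeasurable
    stronglyMeasurable_condExp).neg

theorem memLp_optimalAction {m' : MeasurableSpace Ω}
    {Q : Matrix (Fin c) (Fin a) ℝ} {R : Matrix (Fin c) (Fin b) ℝ} {X : Ω → Vec a}
    (hX : MemLp X 2 μ) : MemLp (optimalAction μ m' Q R X) 2 μ :=
  (memLp_toEuclideanLin (hX.condExp one_le_two) _).neg

/-- The residual is `Q' X - Λ X̂`, and `E[X X̂ᵀ] = E[X̂ X̂ᵀ]` leaves only the posterior covariance.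
The evaluating matrices `Q'`, `R'` may differ from those that define the action, so the formula
serves the senders and the receiver alike. -/
theorem stageCost_optimalAction [IsProbabilityMeasure μ] {m' : MeasurableSpace Ω} (hm : m' ≤ mΩ)
    {Q : Matrix (Fin c) (Fin a) ℝ} {R : Matrix (Fin c) (Fin b) ℝ} {X : Ω → Vec a}
    (hX : MemLp X 2 μ) (Q' : Matrix (Fin c) (Fin a) ℝ) (R' : Matrix (Fin c) (Fin b) ℝ)
    {Λ : Matrix (Fin c) (Fin a) ℝ} (hΛ : Λ = R' * (Rᵀ * R)⁻¹ * Rᵀ * Q) :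
    stageCost μ Q' R' X (optimalAction μ m' Q R X)
      = ENNReal.ofReal ((Q'ᵀ * Q' * crossMoment μ X X).trace
        + ((Λᵀ * Λ - Λᵀ * Q' - Q'ᵀ * Λ)
          * crossMoment μ (μ[X | m']) (μ[X | m'])).trace) := by
  have hX1 : MemLp (μ[X | m']) 2 μ := hX.condExp one_le_two
  have e1 := crossMoment_condExp hm hX hX1 stronglyMeasurable_condExp
  have e2 : crossMoment μ (μ[X | m']) X = crossMoment μ X (μ[X | m']) := by
    rw [← crossMoment_transpose, ← e1, crossMoment_transpose]
  have h1 : stageCost μ Q' R' X (optimalAction μ m' Q R X)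
      = ∫⁻ ω, ENNReal.ofReal (‖Matrix.toEuclideanLin Q' (X ω)
        - Matrix.toEuclideanLin Λ ((μ[X | m']) ω)‖ ^ 2) ∂μ := by
    refine lintegral_congr fun ω => ?_
    rw [optimalAction, map_neg, ← toEuclideanLin_mul_apply, ← sub_eq_add_neg, hΛ]
    simp only [Matrix.mul_assoc]
  have hQ := memLp_toEuclideanLin hX Q'
  have hL := memLp_toEuclideanLin hX1 Λ
  rw [h1, lintegral_norm_sq (memLp_sub hQ hL),
    crossMoment_sub_left hQ hL (memLp_sub hQ hL), crossMoment_sub_right hQ hQ hL,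
    crossMoment_sub_right hL hQ hL, crossMoment_mul_left hX hQ, crossMoment_mul_left hX hL,
    crossMoment_mul_left hX1 hQ, crossMoment_mul_left hX1 hL, crossMoment_mul_right hX hX,
    crossMoment_mul_right hX hX1, crossMoment_mul_right hX1 hX, crossMoment_mul_right hX1 hX1,
    e2, ← e1]
  congr 1
  simp only [sub_mul, Matrix.trace_sub]
  have cyc (M N : Matrix (Fin c) (Fin a) ℝ) (T : Matrix (Fin a) (Fin a) ℝ) :
      (M * (T * Nᵀ)).trace = (Nᵀ * M * T).trace := by
    rw [← Matrix.mul_assoc, Matrix.trace_mul_comm, Matrix.mul_assoc]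
  simp only [cyc]
  ring

/-- The optimal action is optimal, and every action that does as well agrees with it almost
surely. -/
theorem stageCost_optimalAction_le [IsProbabilityMeasure μ] {m' : MeasurableSpace Ω} (hm : m' ≤ mΩ)
    {Q : Matrix (Fin c) (Fin a) ℝ} {R : Matrix (Fin c) (Fin b) ℝ} (hR : IsUnit (Rᵀ * R))
    {X : Ω → Vec a} (hX : MemLp X 2 μ) {u : Ω → Vec b} (hu : StronglyMeasurable[m'] u) :
    stageCost μ Q R X (optimalAction μ m' Q R X) ≤ stageCost μ Q R X u ∧
    (stageCost μ Q R X u ≤ stageCost μ Q R X (optimalAction μ m' Q R X) →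
      u =ᵐ[μ] optimalAction μ m' Q R X) := by
  set v := optimalAction μ m' Q R X with hv
  have hvL : MemLp v 2 μ := memLp_optimalAction hX
  have hX1 : MemLp (μ[X | m']) 2 μ := hX.condExp one_le_two
  have hQX := memLp_toEuclideanLin hX Q
  have hinv : (Rᵀ * R)⁻¹ * (Rᵀ * R) = 1 :=
    Matrix.nonsing_inv_mul _ ((Matrix.isUnit_iff_isUnit_det _).1 hR)
  have hinv' : (Rᵀ * R) * (Rᵀ * R)⁻¹ = 1 :=
    Matrix.mul_nonsing_inv _ ((Matrix.isUnit_iff_isUnit_det _).1 hR)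
  have hleft (y : Vec b) :
      Matrix.toEuclideanLin ((Rᵀ * R)⁻¹ * Rᵀ) (Matrix.toEuclideanLin R y) = y := by
    rw [← toEuclideanLin_mul_apply, Matrix.mul_assoc, hinv, toEuclideanLin_one_apply]
  have hfin : stageCost μ Q R X v < ∞ := by
    rw [stageCost, lintegral_norm_sq (memLp_add hQX (memLp_toEuclideanLin hvL R))]
    exact ENNReal.ofReal_lt_top
  -- Square integrability of `u` is not given. It follows from finite cost, since `(Rᵀ R)⁻¹ Rᵀ`
  -- recovers `u` from `R u`.
  by_cases htop : stageCost μ Q R X u = ∞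
  · rw [htop]
    exact ⟨le_top, fun h => absurd h hfin.not_ge⟩
  have huL : MemLp u 2 μ := by
    have h1 : AEStronglyMeasurable[mΩ]
        (fun ω => Matrix.toEuclideanLin Q (X ω) + Matrix.toEuclideanLin R (u ω)) μ :=
      hQX.1.add ((LinearMap.continuous_of_finiteDimensional _).comp_aestronglyMeasurable
        (hu.mono hm).aestronglyMeasurable)
    have h2 := (memLp_two_of_lintegral_ne_top h1 htop).sub hQX
    have h3 := memLp_toEuclideanLin h2 ((Rᵀ * R)⁻¹ * Rᵀ)
    simpa only [Pi.sub_apply, add_sub_cancel_left, hleft] using h3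
  set d := fun ω => u ω - v ω with hd
  have hdL : MemLp d 2 μ := huL.sub hvL
  have hdm : StronglyMeasurable[m'] d := hu.sub stronglyMeasurable_optimalAction
  have hRd := memLp_toEuclideanLin hdL R
  set Z := fun ω => Matrix.toEuclideanLin Q (X ω) + Matrix.toEuclideanLin R (v ω) with hZ
  have hRv := memLp_toEuclideanLin hvL R
  have hZL : MemLp Z 2 μ := hQX.add hRv
  -- The normal equations: `d` is observable, so `X` may replace its estimate in the moment with
  -- `d`, and `Rᵀ (Q - R (Rᵀ R)⁻¹ Rᵀ Q) = 0`.
  have hort : (crossMoment μ Z (fun ω => Matrix.toEuclideanLin R (d ω))).trace = 0 := by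
    have hvd : crossMoment μ v d = -((Rᵀ * R)⁻¹ * Rᵀ * Q) * crossMoment μ X d := by
      rw [← crossMoment_condExp hm hX hdL hdm, ← crossMoment_mul_left hX1 hdL]
      congr 1
      funext ω
      simp only [hv, optimalAction, map_neg, LinearMap.neg_apply]
    rw [crossMoment_mul_right hZL hdL, hZ, crossMoment_add_left hQX hRv hdL,
      crossMoment_mul_left hX hdL, crossMoment_mul_left hvL hdL, hvd, Matrix.trace_mul_comm,
      Matrix.mul_add]
    have : Rᵀ * (R * (-((Rᵀ * R)⁻¹ * Rᵀ * Q) * crossMoment μ X d))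
        = - (((Rᵀ * R) * (Rᵀ * R)⁻¹) * (Rᵀ * (Q * crossMoment μ X d))) := by
      simp only [Matrix.mul_assoc, Matrix.neg_mul, Matrix.mul_neg]
    rw [this, hinv', Matrix.one_mul, add_neg_cancel, Matrix.trace_zero]
  have hsplit : stageCost μ Q R X u = stageCost μ Q R X v
      + ENNReal.ofReal (crossMoment μ (fun ω => Matrix.toEuclideanLin R (d ω))
        (fun ω => Matrix.toEuclideanLin R (d ω))).trace := by
    have h1 : stageCost μ Q R X u
        = ∫⁻ ω, ENNReal.ofReal (‖Z ω + Matrix.toEuclideanLin R (d ω)‖ ^ 2) ∂μ := by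
      refine lintegral_congr fun ω => ?_
      simp only [hZ, hd, map_sub]
      congr 3
      abel
    have h2 : (crossMoment μ (fun ω => Matrix.toEuclideanLin R (d ω)) Z).trace = 0 := by
      rw [← crossMoment_transpose, Matrix.trace_transpose, hort]
    rw [h1, lintegral_norm_sq (memLp_add hZL hRd), stageCost,
      lintegral_norm_sq hZL, ← ENNReal.ofReal_add,
      crossMoment_add_left hZL hRd (memLp_add hZL hRd), crossMoment_add_right hZL hZL hRd,
      crossMoment_add_right hRd hZL hRd, Matrix.trace_add, Matrix.trace_add, Matrix.trace_add,
      hort, h2, add_zero, zero_add]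
    · exact (Matrix.nonneg_iff_posSemidef.1 (crossMoment_self_nonneg hZL)).trace_nonneg
    · exact (Matrix.nonneg_iff_posSemidef.1 (crossMoment_self_nonneg hRd)).trace_nonneg
  refine ⟨hsplit ▸ le_self_add, fun h => ?_⟩
  rw [hsplit] at h
  have h0 : ENNReal.ofReal (crossMoment μ (fun ω => Matrix.toEuclideanLin R (d ω))
      (fun ω => Matrix.toEuclideanLin R (d ω))).trace = 0 := by
    have h' : stageCost μ Q R X v + ENNReal.ofReal (crossMoment μ
        (fun ω => Matrix.toEuclideanLin R (d ω))
        (fun ω => Matrix.toEuclideanLin R (d ω))).trace ≤ stageCost μ Q R X v + 0 := by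
      rwa [add_zero]
    exact le_antisymm ((ENNReal.add_le_add_iff_left hfin.ne).1 h') zero_le
  filter_upwards [ae_eq_zero_of_trace_crossMoment hRd (ENNReal.ofReal_eq_zero.1 h0)] with ω hω
  have := hleft (d ω)
  rw [hω, map_zero] at this
  exact (sub_eq_zero.1 this.symm)

end CondExp

/-! ### Gaussian vectors: uncorrelated implies independent -/

section Gaussian

variable {Ω : Type*} {mΩ : MeasurableSpace Ω} {μ : Measure Ω} {a b c : ℕ}

theorem crossMoment_of_hasLaw [IsProbabilityMeasure μ] {X : Ω → Vec a} {C : Mat a}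
    (hC : C.PosSemidef) (hX : HasLaw X (multivariateGaussian 0 C) μ) : crossMoment μ X X = C := by
  ext i j
  have h1 : ∀ l, MemLp (fun v : Vec a => v l) 2 (multivariateGaussian 0 C) :=
    fun l => (IsGaussian.memLp_two_id (μ := multivariateGaussian (0 : Vec a) C)).eval_piLp l
  have h0 : ∀ l, ∫ v : Vec a, v l ∂(multivariateGaussian 0 C) = 0 := by
    intro l
    have := (EuclideanSpace.proj l : Vec a →L[ℝ] ℝ).integral_comp_comm
      (IsGaussian.integrable_id (μ := multivariateGaussian (0 : Vec a) C))
    simpa using this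
  have h2 := covariance_eval_multivariateGaussian (μ := (0 : Vec a)) hC i j
  rw [covariance_eq_sub (h1 i) (h1 j), h0, zero_mul, sub_zero] at h2
  rw [crossMoment_apply, ← h2]
  exact hX.integral_comp (f := fun v : Vec a => v i * v j)
    (Measurable.aestronglyMeasurable (by fun_prop))

theorem crossMoment_of_indepFun {X : Ω → Vec a} {Y : Ω → Vec b}
    (h : IndepFun X Y μ) (hX : Integrable X μ) (hY : Integrable Y μ) (h0 : ∫ ω, X ω ∂μ = 0) :
    crossMoment μ X Y = 0 := by
  ext i j
  have h1 : IndepFun (fun ω => X ω i) (fun ω => Y ω j) μ :=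
    h.comp (φ := fun v : Vec a => v i) (ψ := fun v : Vec b => v j) (by fun_prop) (by fun_prop)
  have h2 := (EuclideanSpace.proj i : Vec a →L[ℝ] ℝ).integral_comp_comm hX
  rw [h0, map_zero] at h2
  rw [crossMoment_apply, h1.integral_fun_mul_eq_mul_integral (hX.eval_piLp i).1 (hY.eval_piLp j).1]
  change (∫ ω, X ω i ∂μ) = 0 at h2
  rw [h2, zero_mul, Matrix.zero_apply]

variable {E : Type*} [NormedAddCommGroup E] [NormedSpace ℝ E]

/-- `X` is a continuous linear function of `Z`. -/
def IsLinearImage (Z : Ω → E) (X : Ω → Vec a) : Prop :=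
  ∃ T : E →L[ℝ] Vec a, ∀ ω, X ω = T (Z ω)

namespace IsLinearImage

variable {Z : Ω → E}

theorem zero : IsLinearImage Z (fun _ => (0 : Vec a)) := ⟨0, fun _ => rfl⟩

theorem add {X Y : Ω → Vec a} (hX : IsLinearImage Z X) (hY : IsLinearImage Z Y) :
    IsLinearImage Z (fun ω => X ω + Y ω) := by
  obtain ⟨T, hT⟩ := hX
  obtain ⟨T', hT'⟩ := hY
  exact ⟨T + T', fun ω => by simp only [hT, hT', _root_.add_apply]⟩

theorem toEuclideanLin {X : Ω → Vec a} (hX : IsLinearImage Z X) (M : Matrix (Fin b) (Fin a) ℝ) :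
    IsLinearImage Z (fun ω => Matrix.toEuclideanLin M (X ω)) := by
  obtain ⟨T, hT⟩ := hX
  exact ⟨(LinearMap.toContinuousLinearMap (Matrix.toEuclideanLin M)).comp T,
    fun ω => by simp only [hT]; rfl⟩

theorem sub {X Y : Ω → Vec a} (hX : IsLinearImage Z X) (hY : IsLinearImage Z Y) :
    IsLinearImage Z (fun ω => X ω - Y ω) := by
  obtain ⟨T, hT⟩ := hX
  obtain ⟨T', hT'⟩ := hY
  exact ⟨T - T', fun ω => by simp only [hT, hT', _root_.sub_apply]⟩

theorem memLp {X : Ω → Vec a} (hX : IsLinearImage Z X) (hZ : MemLp Z 2 μ) : MemLp X 2 μ := by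
  obtain ⟨T, hT⟩ := hX
  rw [funext hT]
  exact T.comp_memLp' hZ

theorem integral_eq_zero [CompleteSpace E] {X : Ω → Vec a} (hX : IsLinearImage Z X)
    (hZ : Integrable Z μ) (h0 : ∫ ω, Z ω ∂μ = 0) : ∫ ω, X ω ∂μ = 0 := by
  obtain ⟨T, hT⟩ := hX
  simp only [hT]
  rw [T.integral_comp_comm hZ, h0, map_zero]

/-- Uncorrelated linear images of a centred Gaussian vector are independent. -/
theorem indepFun [CompleteSpace E] [MeasurableSpace E] [BorelSpace E]
    [SecondCountableTopology E] {κ : Type*} [Finite κ] (hZ : HasGaussianLaw Z μ)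
    (h0 : ∫ ω, Z ω ∂μ = 0) {X : Ω → Vec a} {Y : κ → Ω → Vec b} (hX : IsLinearImage Z X)
    (hY : ∀ j, IsLinearImage Z (Y j)) (hXY : ∀ j, crossMoment μ X (Y j) = 0) :
    IndepFun X (fun ω j => Y j ω) μ := by
  have := Fintype.ofFinite κ
  have := hZ.isProbabilityMeasure
  have hXL := hX.memLp hZ.memLp_two
  have hYL := fun j => (hY j).memLp hZ.memLp_two
  have hX0 := hX.integral_eq_zero hZ.integrable h0
  -- Joint Gaussianity: all coordinates together are one continuous linear image of `Z`.
  have hlaw : HasGaussianLaw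
      (fun ω => (fun i => X ω i, fun l : κ × Fin b => Y l.1 ω l.2)) μ := by
    obtain ⟨T, hT⟩ := hX
    choose T' hT' using hY
    have heq : (fun ω => (fun i => X ω i, fun l : κ × Fin b => Y l.1 ω l.2))
        = fun ω => ((ContinuousLinearMap.pi fun i : Fin a =>
          (EuclideanSpace.proj i : Vec a →L[ℝ] ℝ).comp T).prod
          (ContinuousLinearMap.pi fun l : κ × Fin b =>
            (EuclideanSpace.proj l.2 : Vec b →L[ℝ] ℝ).comp (T' l.1))) (Z ω) := by
      funext ω
      simp only [hT, hT']
      rfl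
    rw [heq]
    exact hZ.map_fun _
  have key := HasGaussianLaw.indepFun_of_covariance_eval (X := fun i ω => X ω i)
    (Y := fun l : κ × Fin b => fun ω => Y l.1 ω l.2) hlaw (by
      intro i l
      rw [covariance_eq_sub (hXL.eval_piLp i) ((hYL l.1).eval_piLp l.2)]
      have h1 := (EuclideanSpace.proj i : Vec a →L[ℝ] ℝ).integral_comp_comm
        (hXL.integrable one_le_two)
      rw [hX0, map_zero] at h1
      change (∫ ω, X ω i ∂μ) = 0 at h1
      rw [h1, zero_mul, sub_zero]
      have := congrFun (congrFun (hXY l.1) i) l.2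
      rwa [crossMoment_apply] at this)
  exact key.comp (φ := fun v => WithLp.toLp 2 v)
    (ψ := fun f j => WithLp.toLp 2 fun i => f (j, i)) (by fun_prop) (by fun_prop)

end IsLinearImage

end Gaussian

/-! ### Moments of the state process and of its filter -/

section StateProcess

variable {m p t q : ℕ} {Ω : Type*} {G : Game m p t q} {x w : ℕ → Ω → Vec p}

/-- The vector of the initial state and the noises that drive the state process. -/
def driver (G : Game m p t q) (x w : ℕ → Ω → Vec p) (ω : Ω) (i : Fin (G.n + 1)) : Vec p :=
  (Fin.cons (x 0) (fun k : Fin G.n => w k) : Fin (G.n + 1) → Ω → Vec p) i ω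

theorem isLinearImage_driver_init : IsLinearImage (driver G x w) (x 0) :=
  ⟨ContinuousLinearMap.proj 0, fun _ => rfl⟩

theorem isLinearImage_driver_noise {k : ℕ} (hk : k < G.n) : IsLinearImage (driver G x w) (w k) :=
  ⟨ContinuousLinearMap.proj (Fin.succ ⟨k, hk⟩), fun _ => rfl⟩

variable [MeasurableSpace Ω] {μ : Measure Ω}

namespace IsStateProcess

theorem hasGaussianLaw_driver (hx : IsStateProcess G μ x w) :
    HasGaussianLaw (driver G x w) μ := by
  refine iIndepFun.hasGaussianLaw (fun i => ?_) hx.indep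
  induction i using Fin.cases with
  | zero => exact hx.law_init.hasGaussianLaw
  | succ k => exact (hx.law_noise k k.2).hasGaussianLaw

theorem integral_driver (hx : IsStateProcess G μ x w) : ∫ ω, driver G x w ω ∂μ = 0 := by
  funext i
  have h := (ContinuousLinearMap.proj (R := ℝ) (φ := fun _ : Fin (G.n + 1) => Vec p)
    i).integral_comp_comm hx.hasGaussianLaw_driver.integrable
  change (∫ ω, driver G x w ω i ∂μ) = (∫ ω, driver G x w ω ∂μ) i at h
  rw [← h, Pi.zero_apply]
  induction i using Fin.cases with
  | zero => exact hx.law_init.integral_eq.trans integral_id_multivariateGaussian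
  | succ k => exact (hx.law_noise k k.2).integral_eq.trans integral_id_multivariateGaussian

theorem isLinearImage_state (hx : IsStateProcess G μ x w) {k : ℕ} (hk : k ≤ G.n) :
    IsLinearImage (driver G x w) (x k) := by
  induction k with
  | zero => exact isLinearImage_driver_init
  | succ k ih =>
    rw [funext (hx.dynamics k hk)]
    exact ((ih (by omega)).toEuclideanLin G.A).add (isLinearImage_driver_noise hk)

theorem memLp_of_isLinearImage (hx : IsStateProcess G μ x w) {a : ℕ} {X : Ω → Vec a}
    (hX : IsLinearImage (driver G x w) X) : MemLp X 2 μ :=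
  hX.memLp hx.hasGaussianLaw_driver.memLp_two

theorem memLp_state (hx : IsStateProcess G μ x w) {k : ℕ} (hk : k ≤ G.n) : MemLp (x k) 2 μ :=
  hx.memLp_of_isLinearImage (hx.isLinearImage_state hk)

theorem memLp_noise (hx : IsStateProcess G μ x w) {k : ℕ} (hk : k < G.n) : MemLp (w k) 2 μ :=
  hx.memLp_of_isLinearImage (isLinearImage_driver_noise hk)

theorem measurable_state (hx : IsStateProcess G μ x w) {k : ℕ} (hk : k ≤ G.n) :
    Measurable (x k) := by
  induction k with
  | zero => exact hx.measurable_init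
  | succ k ih =>
    rw [funext (hx.dynamics k hk)]
    exact ((measurable_toEuclideanLin G.A).comp (ih (by omega))).add (hx.measurable_noise k hk)

/-- The state at time `k` is built from `x 0` and the noises before `k`, all independent of the
centred `w j`. -/
theorem crossMoment_noise_state [IsProbabilityMeasure μ] (hx : IsStateProcess G μ x w)
    {j k : ℕ} (hkj : k ≤ j) (hj : j < G.n) : crossMoment μ (w j) (x k) = 0 := by
  have hw0 : ∫ ω, w j ω ∂μ = 0 := (isLinearImage_driver_noise hj).integral_eq_zero
    hx.hasGaussianLaw_driver.integrable hx.integral_driver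
  have hwL := hx.memLp_noise hj
  induction k with
  | zero =>
    have h := hx.indep.indepFun (i := Fin.succ ⟨j, hj⟩) (j := 0) (Fin.succ_ne_zero _)
    exact crossMoment_of_indepFun h (hwL.integrable one_le_two)
      ((hx.memLp_state (Nat.zero_le _)).integrable one_le_two) hw0
  | succ k ih =>
    have hkL := hx.memLp_state (k := k) (by omega)
    have hne : (Fin.succ ⟨j, hj⟩ : Fin (G.n + 1)) ≠ Fin.succ ⟨k, by omega⟩ := by
      simp only [ne_eq, Fin.succ_inj, Fin.mk.injEq]
      omega
    have h := hx.indep.indepFun hne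
    have hw := crossMoment_of_indepFun (X := w j) (Y := w k) h (hwL.integrable one_le_two)
      ((hx.memLp_noise (by omega)).integrable one_le_two) hw0
    rw [funext (hx.dynamics k (by omega)),
      crossMoment_add_right hwL (memLp_toEuclideanLin hkL _) (hx.memLp_noise (by omega)),
      crossMoment_mul_right hwL hkL, ih (by omega), hw, Matrix.zero_mul, add_zero]

theorem crossMoment_state [IsProbabilityMeasure μ] (hx : IsStateProcess G μ x w) {k : ℕ}
    (hk : k ≤ G.n) : crossMoment μ (x k) (x k) = G.stateCov k := by
  induction k with
  | zero => exact crossMoment_of_hasLaw G.covInit_psd hx.law_init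
  | succ k ih =>
    have hkL := hx.memLp_state (k := k) (by omega)
    have hAL := memLp_toEuclideanLin hkL G.A
    have hwL := hx.memLp_noise hk
    have h1 := hx.crossMoment_noise_state le_rfl hk
    have h2 : crossMoment μ (x k) (w k) = 0 := by
      rw [← crossMoment_transpose, h1, Matrix.transpose_zero]
    rw [funext (hx.dynamics k hk), crossMoment_add_left hAL hwL (memLp_add hAL hwL),
      crossMoment_add_right hAL hAL hwL, crossMoment_add_right hwL hAL hwL,
      crossMoment_mul_left hkL hAL, crossMoment_mul_left hkL hwL, crossMoment_mul_right hkL hkL,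
      crossMoment_mul_right hwL hkL, ih (by omega), h1, h2,
      crossMoment_of_hasLaw G.covNoise_psd (hx.law_noise k hk), Game.stateCov]
    simp [mul_assoc]

end IsStateProcess

/-! ### The linear filter that attains the stable posteriors -/

/-- The gain of the linear filter with innovation covariance `D` and projection matrix `P`. -/
noncomputable def filterGain (D P : Mat p) : Mat p := CFC.sqrt D * P * (CFC.sqrt D)⁻¹

/-- The linear filter for the state. -/
noncomputable def stateFilter (G : Game m p t q) (S P : ℕ → Mat p) (x : ℕ → Ω → Vec p) :
    ℕ → Ω → Vec p
  | 0 => fun _ => 0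
  | k + 1 => fun ω => Matrix.toEuclideanLin G.A (stateFilter G S P x k ω)
    + Matrix.toEuclideanLin (filterGain (G.innovCov S k) (P (k + 1)))
      (x (k + 1) ω - Matrix.toEuclideanLin G.A (stateFilter G S P x k ω))

variable {S P : ℕ → Mat p}

namespace IsStateProcess

theorem isLinearImage_stateFilter (hx : IsStateProcess G μ x w) {k : ℕ} (hk : k ≤ G.n) :
    IsLinearImage (driver G x w) (stateFilter G S P x k) := by
  induction k with
  | zero => exact IsLinearImage.zero
  | succ k ih =>
    have h := (ih (by omega)).toEuclideanLin G.A
    exact h.add (((hx.isLinearImage_state hk).sub h).toEuclideanLin _)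

theorem memLp_stateFilter (hx : IsStateProcess G μ x w) {k : ℕ} (hk : k ≤ G.n) :
    MemLp (stateFilter G S P x k) 2 μ :=
  hx.memLp_of_isLinearImage (hx.isLinearImage_stateFilter hk)

theorem crossMoment_noise_stateFilter [IsProbabilityMeasure μ] (hx : IsStateProcess G μ x w)
    {j k : ℕ} (hkj : k ≤ j) (hj : j < G.n) :
    crossMoment μ (w j) (stateFilter G S P x k) = 0 := by
  have hwL := hx.memLp_noise hj
  induction k with
  | zero =>
    rw [← crossMoment_transpose]
    exact congrArg Matrix.transpose (crossMoment_zero_left _)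
  | succ k ih =>
    have hfL : MemLp (stateFilter G S P x k) 2 μ := hx.memLp_stateFilter (by omega)
    have hAL := memLp_toEuclideanLin hfL G.A
    have hxL := hx.memLp_state (k := k + 1) (by omega)
    simp only [stateFilter]
    rw [crossMoment_add_right hwL hAL (memLp_toEuclideanLin (memLp_sub hxL hAL) _),
      crossMoment_mul_right hwL (memLp_sub hxL hAL), crossMoment_sub_right hwL hxL hAL,
      crossMoment_mul_right hwL hfL, ih (by omega), hx.crossMoment_noise_state hkj hj]
    simp

variable [IsProbabilityMeasure μ]

/-- The filter attains the covariances `S`, and its error is uncorrelated with it. -/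
theorem crossMoment_stateFilter (hx : IsStateProcess G μ x w) (hS : IsStablePosteriorSeq G S P)
    (hD : ∀ k < G.n, (G.innovCov S k).PosDef) {k : ℕ} (hk : k ≤ G.n) :
    crossMoment μ (stateFilter G S P x k) (stateFilter G S P x k) = S k ∧
    crossMoment μ (x k) (stateFilter G S P x k) = S k := by
  induction k with
  | zero =>
    constructor
    · exact (crossMoment_zero_left _).trans hS.zero.symm
    · rw [← crossMoment_transpose, hS.zero]
      exact congrArg Matrix.transpose (crossMoment_zero_left _)
  | succ k ih =>
    obtain ⟨ih1, ih2⟩ := ih (by omega)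
    have hfL : MemLp (stateFilter G S P x k) 2 μ := hx.memLp_stateFilter (by omega)
    have hAL := memLp_toEuclideanLin hfL G.A
    have hkL := hx.memLp_state (k := k) (by omega)
    have hxL := hx.memLp_state hk
    have hwL := hx.memLp_noise hk
    obtain ⟨hPt, hPP⟩ := hS.proj (k + 1) (Finset.mem_Icc.2 ⟨by omega, hk⟩)
    have hSt : (S k)ᵀ = S k := by rw [← ih1, crossMoment_transpose]
    have hxf : crossMoment μ (x (k + 1)) (stateFilter G S P x k) = G.A * S k := by
      rw [funext (hx.dynamics k hk),
        crossMoment_add_left (memLp_toEuclideanLin hkL _) hwL hfL, crossMoment_mul_left hkL hfL,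
        ih2, hx.crossMoment_noise_stateFilter le_rfl hk, add_zero]
    have hfx : crossMoment μ (stateFilter G S P x k) (x (k + 1)) = S k * G.Aᵀ := by
      rw [← crossMoment_transpose, hxf, Matrix.transpose_mul, hSt]
    -- The innovation: uncorrelated with the previous filter value, and of covariance `D`.
    set ν := fun ω => x (k + 1) ω - Matrix.toEuclideanLin G.A (stateFilter G S P x k ω) with hν
    have hνL : MemLp ν 2 μ := memLp_sub hxL hAL
    have hνf : crossMoment μ ν (stateFilter G S P x k) = 0 := by
      rw [hν, crossMoment_sub_left hxL hAL hfL, hxf, crossMoment_mul_left hfL hfL, ih1, sub_self]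
    have hfν : crossMoment μ (stateFilter G S P x k) ν = 0 := by
      rw [← crossMoment_transpose, hνf, Matrix.transpose_zero]
    have hxν : crossMoment μ (x (k + 1)) ν = G.innovCov S k := by
      rw [hν, crossMoment_sub_right hxL hxL hAL, hx.crossMoment_state hk,
        crossMoment_mul_right hxL hfL, hxf, Game.innovCov]
    have hνν : crossMoment μ ν ν = G.innovCov S k := by
      nth_rewrite 1 [hν]
      rw [crossMoment_sub_left hxL hAL hνL, hxν, crossMoment_mul_left hfL hνL, hfν, mul_zero,
        sub_zero]
    set D := G.innovCov S k with hDdef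
    have hDD := hD k hk
    rw [← hDdef] at hDD
    have hHt : (filterGain D (P (k + 1)))ᵀ = (CFC.sqrt D)⁻¹ * P (k + 1) * CFC.sqrt D := by
      rw [filterGain, Matrix.transpose_mul, Matrix.transpose_mul, Mat.sqrt_transpose,
        Mat.sqrt_inv_transpose, hPt, mul_assoc]
    -- `D Hᵀ` and `H D Hᵀ` agree because `P² = P`. Their common value is the increment of `S`, which
    -- is why both moments in the claim coincide.
    have hDH : D * (filterGain D (P (k + 1)))ᵀ = CFC.sqrt D * P (k + 1) * CFC.sqrt D := by
      rw [hHt, ← mul_assoc, ← mul_assoc, Mat.mul_inv_sqrt hDD]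
    have hHD : filterGain D (P (k + 1)) * (D * (filterGain D (P (k + 1)))ᵀ)
        = CFC.sqrt D * P (k + 1) * CFC.sqrt D := by
      rw [hDH, filterGain]
      calc _ = CFC.sqrt D * P (k + 1) * ((CFC.sqrt D)⁻¹ * CFC.sqrt D) * P (k + 1)
            * CFC.sqrt D := by simp only [mul_assoc]
        _ = _ := by rw [Mat.inv_mul_sqrt hDD, mul_one, mul_assoc (CFC.sqrt D), hPP]
    have hHν := memLp_toEuclideanLin hνL (filterGain D (P (k + 1)))
    have hf : stateFilter G S P x (k + 1) = fun ω =>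
        Matrix.toEuclideanLin G.A (stateFilter G S P x k ω) + Matrix.toEuclideanLin (filterGain D (P (k + 1))) (ν ω) := rfl
    rw [hf, hS.recursion k hk, ← hDdef]
    constructor
    · rw [crossMoment_add_left hAL hHν (memLp_add hAL hHν), crossMoment_add_right hAL hAL hHν,
        crossMoment_add_right hHν hAL hHν, crossMoment_mul_left hfL hAL,
        crossMoment_mul_left hfL hHν, crossMoment_mul_left hνL hAL, crossMoment_mul_left hνL hHν,
        crossMoment_mul_right hfL hfL, crossMoment_mul_right hfL hνL,
        crossMoment_mul_right hνL hfL, crossMoment_mul_right hνL hνL, hfν, hνf, hνν, ih1, hHD]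
      simp [mul_assoc]
    · rw [crossMoment_add_right hxL hAL hHν, crossMoment_mul_right hxL hfL,
        crossMoment_mul_right hxL hνL, hxf, hxν, hDH]

/-- The error of the filter is uncorrelated with the linear signals. -/
theorem crossMoment_stateFilter_error (hx : IsStateProcess G μ x w) (hS : IsStablePosteriorSeq G S P)
    (hD : ∀ k < G.n, (G.innovCov S k).PosDef) {L : ℕ → Mat p}
    (hL : ∀ k < G.n, filterGain (G.innovCov S k) (P (k + 1)) * G.innovCov S k * L (k + 1)
      = G.innovCov S k * L (k + 1))
    {k l : ℕ} (hk : k ≤ G.n) (hl : l ∈ Finset.Icc 1 k) :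
    crossMoment μ (fun ω => x k ω - stateFilter G S P x k ω) (x l) * L l = 0 := by
  induction k with
  | zero => simp at hl
  | succ k ih =>
    rw [Finset.mem_Icc] at hl
    have hfL : MemLp (stateFilter G S P x k) 2 μ := hx.memLp_stateFilter (by omega)
    have hAL := memLp_toEuclideanLin hfL G.A
    have hkL := hx.memLp_state (k := k) (by omega)
    have hxL := hx.memLp_state hk
    have hwL := hx.memLp_noise hk
    have hlL := hx.memLp_state (k := l) (by omega)
    set ν := fun ω => x (k + 1) ω - Matrix.toEuclideanLin G.A (stateFilter G S P x k ω) with hν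
    have hνL : MemLp ν 2 μ := memLp_sub hxL hAL
    have herr : (fun ω => x (k + 1) ω - stateFilter G S P x (k + 1) ω) = fun ω => ν ω -
        Matrix.toEuclideanLin (filterGain (G.innovCov S k) (P (k + 1))) (ν ω) := by
      funext ω
      simp only [stateFilter, hν]
      abel
    rw [herr, crossMoment_sub_left hνL (memLp_toEuclideanLin hνL _) hlL,
      crossMoment_mul_left hνL hlL]
    -- For the newest signal `E[ν xᵀ] = D`, and `(1 - H) D L = 0` by `hL`. For an older one, `ν` is
    -- `A` times the previous error plus fresh noise, and induction applies.
    rcases Nat.lt_or_ge k l with h | h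
    · obtain rfl : l = k + 1 := by omega
      obtain ⟨h1, h2⟩ := hx.crossMoment_stateFilter hS hD (k := k) (by omega)
      have hSt : (S k)ᵀ = S k := by rw [← h1, crossMoment_transpose]
      have hfx : crossMoment μ (stateFilter G S P x k) (x (k + 1)) = S k * G.Aᵀ := by
        rw [← crossMoment_transpose, funext (hx.dynamics k hk),
          crossMoment_add_left (memLp_toEuclideanLin hkL _) hwL hfL, crossMoment_mul_left hkL hfL,
          h2, hx.crossMoment_noise_stateFilter le_rfl hk, add_zero, Matrix.transpose_mul, hSt]
      have hνx : crossMoment μ ν (x (k + 1)) = G.innovCov S k := by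
        rw [hν, crossMoment_sub_left hxL hAL hxL, hx.crossMoment_state hk,
          crossMoment_mul_left hfL hxL, hfx, Game.innovCov, mul_assoc]
      rw [hνx, sub_mul, hL k hk, sub_self]
    · have hν' : ν = fun ω =>
          Matrix.toEuclideanLin G.A (x k ω - stateFilter G S P x k ω) + w k ω := by
        funext ω
        simp only [hν, hx.dynamics k hk, map_sub]
        abel
      have hνl : crossMoment μ ν (x l) * L l = 0 := by
        rw [hν', crossMoment_add_left (memLp_toEuclideanLin (memLp_sub hkL hfL) _) hwL hlL,
          crossMoment_mul_left (memLp_sub hkL hfL) hlL, hx.crossMoment_noise_state h hk, add_zero,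
          mul_assoc, ih (by omega) (Finset.mem_Icc.2 ⟨hl.1, h⟩), mul_zero]
      rw [sub_mul, mul_assoc, hνl, mul_zero, sub_zero]

end IsStateProcess

end StateProcess

/-! ### Best responses, information and the equilibrium -/

section Equilibrium

variable {m p t q : ℕ} {Ω : Type*} {G : Game m p t q} {x w : ℕ → Ω → Vec p} {S P : ℕ → Mat p}

theorem comap_info_mono (η : Profile m p) (x : ℕ → Ω → Vec p) {k l : ℕ} (hkl : k ≤ l) :
    MeasurableSpace.comap (info η x k) inferInstance
      ≤ MeasurableSpace.comap (info η x l) inferInstance := by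
  have h : info η x k = (fun (f : Fin m → Finset.Icc 1 l → Vec p) i (j : Finset.Icc 1 k) =>
      f i ⟨j, Finset.Icc_subset_Icc_right hkl j.2⟩) ∘ info η x l := rfl
  rw [h, ← MeasurableSpace.comap_comp]
  refine MeasurableSpace.comap_mono (Measurable.comap_le ?_)
  fun_prop

/-- When all senders use the same policy, a deviation of one of them does not lose information. -/
theorem comap_info_le_update (hm : 2 ≤ m) (η₀ : SenderPolicy p) (x : ℕ → Ω → Vec p) (k : ℕ)
    (i : Fin m) (ηi : SenderPolicy p) :
    MeasurableSpace.comap (info (fun _ : Fin m => η₀) x k) inferInstance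
      ≤ MeasurableSpace.comap (info (Function.update (fun _ => η₀) i ηi) x k) inferInstance := by
  have : Nontrivial (Fin m) := Fin.nontrivial_iff_two_le.2 hm
  -- A sender other than the deviator still transmits the common signals.
  obtain ⟨j, hj⟩ := exists_ne i
  have h : info (fun _ : Fin m => η₀) x k
      = (fun (f : Fin m → Finset.Icc 1 k → Vec p) (_ : Fin m) l => f j l)
        ∘ info (Function.update (fun _ => η₀) i ηi) x k := by
    funext ω _ l
    simp [info, Function.update_of_ne hj]
  rw [h, ← MeasurableSpace.comap_comp]
  refine MeasurableSpace.comap_mono (Measurable.comap_le ?_)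
  fun_prop

theorem signal_linearPolicy (L : ℕ → Mat p) (x : ℕ → Ω → Vec p) {k : ℕ} (hk : 1 ≤ k) (ω : Ω) :
    signal (linearPolicy L) x k ω = Matrix.toEuclideanLin (L k)ᵀ (x k ω) := by
  simp [signal, linearPolicy, hk]

/-- The filter is a function of the linear signals. -/
theorem stronglyMeasurable_stateFilter (hm : 0 < m) {L M : ℕ → Mat p}
    (hM : ∀ k < G.n, filterGain (G.innovCov S k) (P (k + 1)) = M k * (L (k + 1))ᵀ) {k : ℕ}
    (hk : k ≤ G.n) :
    StronglyMeasurable[MeasurableSpace.comap (info (fun _ : Fin m => linearPolicy L) x k)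
      inferInstance] (stateFilter G S P x k) := by
  induction k with
  | zero => exact stronglyMeasurable_const
  | succ k ih =>
    have h1 := (ih (by omega)).mono (comap_info_mono (fun _ : Fin m => linearPolicy L) x k.le_succ)
    have h2 : StronglyMeasurable[MeasurableSpace.comap
        (info (fun _ : Fin m => linearPolicy L) x (k + 1)) inferInstance]
        (fun ω => Matrix.toEuclideanLin (L (k + 1))ᵀ (x (k + 1) ω)) := by
      have h3 : Measurable fun f : Fin m → Finset.Icc 1 (k + 1) → Vec p =>
          f ⟨0, hm⟩ ⟨k + 1, by simp⟩ := by fun_prop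
      convert (h3.comp (comap_measurable
        (info (fun _ : Fin m => linearPolicy L) x (k + 1)))).stronglyMeasurable using 1
      funext ω
      exact (signal_linearPolicy L x (by omega) ω).symm
    have hc (N : Mat p) : Continuous fun v : Vec p => Matrix.toEuclideanLin N v :=
      LinearMap.continuous_of_finiteDimensional _
    have h4 := (hc G.A).comp_stronglyMeasurable h1
    -- Since the gain factors as `M Lᵀ`, the update sees the new state only through the signal `Lᵀ
    -- x`.
    convert h4.add ((hc (M k)).comp_stronglyMeasurable
      (h2.sub ((hc (L (k + 1))ᵀ).comp_stronglyMeasurable h4))) using 1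
    funext ω
    simp only [stateFilter, hM k hk, toEuclideanLin_mul_apply, map_sub, Pi.add_apply,
      Pi.sub_apply]

theorem stronglyMeasurable_action (η : Profile m p) (γ : ReceiverPolicy m p t)
    (x : ℕ → Ω → Vec p) (k : ℕ) :
    StronglyMeasurable[MeasurableSpace.comap (info η x k) inferInstance] (action η γ x k) :=
  ((γ.measurable k).comp (comap_measurable (info η x k))).stronglyMeasurable

variable [MeasurableSpace Ω] {μ : Measure Ω}

namespace IsStateProcess

theorem measurable_info (hx : IsStateProcess G μ x w) (η : Profile m p) {k : ℕ} (hk : k ≤ G.n) :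
    Measurable (info η x k) := by
  refine measurable_pi_iff.2 fun i => measurable_pi_iff.2 fun j => ?_
  refine ((η i).measurable j).comp (measurable_pi_iff.2 fun l => hx.measurable_state ?_)
  have hj := Finset.mem_Icc.1 j.2
  have hl := Finset.mem_Icc.1 l.2
  omega

theorem measurable_action (hx : IsStateProcess G μ x w) (η : Profile m p)
    (γ : ReceiverPolicy m p t) {k : ℕ} (hk : k ≤ G.n) : Measurable (action η γ x k) :=
  (γ.measurable k).comp (hx.measurable_info η hk)

theorem cost_eq_sum (hx : IsStateProcess G μ x w) (Q : ℕ → Matrix (Fin q) (Fin p) ℝ)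
    (R : ℕ → Matrix (Fin q) (Fin t) ℝ) {K : ℕ} (hK : K ≤ G.n) (η : Profile m p)
    (γ : ReceiverPolicy m p t) : cost μ x Q R K η γ
      = ∑ k ∈ Finset.Icc 1 K, stageCost μ (Q k) (R k) (x k) (action η γ x k) := by
  rw [cost, lintegral_finsetSum]
  · rfl
  · intro k hk
    have hk' : k ≤ G.n := (Finset.mem_Icc.1 hk).2.trans hK
    have h1 := (measurable_toEuclideanLin (Q k)).comp (hx.measurable_state hk')
    have h2 := (measurable_toEuclideanLin (R k)).comp (hx.measurable_action η γ hk')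
    exact ((h1.add h2).norm.pow_const 2).ennreal_ofReal

end IsStateProcess

/-- The action of a receiver that best responds to `η` at stage `k`. -/
noncomputable def bestAction (G : Game m p t q) (μ : Measure Ω) (x : ℕ → Ω → Vec p)
    (η : Profile m p) (k : ℕ) : Ω → Vec t :=
  optimalAction μ (MeasurableSpace.comap (info η x k) inferInstance) (G.Qr k) (G.Rr k) (x k)

/-- Doob–Dynkin: a vector measurable for the receiver's information is a Borel function of the
signals. -/
theorem exists_action_eq_bestAction (G : Game m p t q) (μ : Measure Ω) (x : ℕ → Ω → Vec p)
    (η : Profile m p) :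
    ∃ γ : ReceiverPolicy m p t, ∀ k, action η γ x k = bestAction G μ x η k := by
  have h (k) : ∃ g : (Fin m → Finset.Icc 1 k → Vec p) → Vec t, StronglyMeasurable g ∧
      bestAction G μ x η k = g ∘ info η x k :=
    stronglyMeasurable_optimalAction.exists_eq_measurable_comp
  choose g hg hg' using h
  exact ⟨⟨g, fun k => (hg k).measurable⟩, fun k => (hg' k).symm⟩

variable [IsProbabilityMeasure μ]

namespace IsStateProcess

theorem stageCost_bestAction_le (hx : IsStateProcess G μ x w) (η : Profile m p)
    (γ : ReceiverPolicy m p t) {k : ℕ} (hk : k ∈ Finset.Icc 1 G.n) :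
    stageCost μ (G.Qr k) (G.Rr k) (x k) (bestAction G μ x η k)
      ≤ stageCost μ (G.Qr k) (G.Rr k) (x k) (action η γ x k) ∧
    (stageCost μ (G.Qr k) (G.Rr k) (x k) (action η γ x k)
      ≤ stageCost μ (G.Qr k) (G.Rr k) (x k) (bestAction G μ x η k) →
      action η γ x k =ᵐ[μ] bestAction G μ x η k) :=
  have hk' := (Finset.mem_Icc.1 hk).2
  stageCost_optimalAction_le (hx.measurable_info η hk').comap_le (G.Rr_invertible k hk)
    (hx.memLp_state hk') (stronglyMeasurable_action η γ x k)

theorem exists_isBestResponse (hx : IsStateProcess G μ x w) (η : Profile m p) :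
    ∃ γ : ReceiverPolicy m p t, IsBestResponse G μ x η γ := by
  obtain ⟨γ, hγ⟩ := exists_action_eq_bestAction G μ x η
  refine ⟨γ, fun K hK γ' => ?_⟩
  rw [Finset.mem_Icc] at hK
  rw [hx.cost_eq_sum _ _ hK.2, hx.cost_eq_sum _ _ hK.2]
  refine Finset.sum_le_sum fun k hk => ?_
  rw [hγ]
  rw [Finset.mem_Icc] at hk
  exact (hx.stageCost_bestAction_le η γ' (Finset.mem_Icc.2 ⟨hk.1, hk.2.trans hK.2⟩)).1

theorem stageCost_bestAction (hx : IsStateProcess G μ x w) (η : Profile m p)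
    {k : ℕ} (hk : k ≤ G.n) (Q : Matrix (Fin q) (Fin p) ℝ) (R : Matrix (Fin q) (Fin t) ℝ)
    {Λ : Matrix (Fin q) (Fin p) ℝ}
    (hΛ : Λ = R * ((G.Rr k)ᵀ * G.Rr k)⁻¹ * (G.Rr k)ᵀ * G.Qr k) :
    stageCost μ Q R (x k) (bestAction G μ x η k)
      = ENNReal.ofReal ((Qᵀ * Q * crossMoment μ (x k) (x k)).trace
        + ((Λᵀ * Λ - Λᵀ * Q - Qᵀ * Λ) * posteriorCov μ x η k).trace) :=
  stageCost_optimalAction (hx.measurable_info η hk).comap_le (hx.memLp_state hk) Q R hΛ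

/-- Every best response of the receiver plays the best action almost surely. -/
theorem action_ae_eq_bestAction (hx : IsStateProcess G μ x w) {η : Profile m p}
    {γ : ReceiverPolicy m p t} (hγ : IsBestResponse G μ x η γ) {k : ℕ}
    (hk : k ∈ Finset.Icc 1 G.n) : action η γ x k =ᵐ[μ] bestAction G μ x η k := by
  refine (hx.stageCost_bestAction_le η γ hk).2 ?_
  obtain ⟨γ', hγ'⟩ := exists_action_eq_bestAction G μ x η
  have hn : G.n ∈ Finset.Icc 1 G.n := by
    rw [Finset.mem_Icc] at hk ⊢
    omega
  have h := hγ G.n hn γ'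
  rw [hx.cost_eq_sum _ _ le_rfl, hx.cost_eq_sum _ _ le_rfl] at h
  simp only [hγ'] at h
  -- No stage can beat its own optimum, so equality of the totals leaves no slack at stage `k`; the
  -- remaining optimal costs are finite and cancel.
  rw [← Finset.add_sum_erase _ _ hk, ← Finset.add_sum_erase _ _ hk] at h
  have hle : ∑ l ∈ (Finset.Icc 1 G.n).erase k,
        stageCost μ (G.Qr l) (G.Rr l) (x l) (bestAction G μ x η l)
      ≤ ∑ l ∈ (Finset.Icc 1 G.n).erase k,
        stageCost μ (G.Qr l) (G.Rr l) (x l) (action η γ x l) :=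
    Finset.sum_le_sum fun l hl => (hx.stageCost_bestAction_le η γ (Finset.mem_of_mem_erase hl)).1
  have hfin : ∑ l ∈ (Finset.Icc 1 G.n).erase k,
      stageCost μ (G.Qr l) (G.Rr l) (x l) (bestAction G μ x η l) ≠ ∞ := by
    refine ENNReal.sum_ne_top.2 fun l hl => ?_
    rw [hx.stageCost_bestAction η (Finset.mem_Icc.1 (Finset.mem_of_mem_erase hl)).2 _ _ rfl]
    exact ENNReal.ofReal_ne_top
  exact (ENNReal.add_le_add_iff_right hfin).1 ((add_le_add_right hle _).trans h)

/-- The cost of a sender when the receiver best responds. -/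
theorem cost_of_isBestResponse (hx : IsStateProcess G μ x w) {η : Profile m p}
    {γ : ReceiverPolicy m p t} (hγ : IsBestResponse G μ x η γ) (i : Fin m) {K : ℕ}
    (hK : K ≤ G.n) : cost μ x (G.Q i) (G.R i) K η γ = ∑ k ∈ Finset.Icc 1 K,
      ENNReal.ofReal (((G.Q i k)ᵀ * G.Q i k * G.stateCov k).trace
        + (G.V i k * posteriorCov μ x η k).trace) := by
  rw [hx.cost_eq_sum _ _ hK]
  refine Finset.sum_congr rfl fun k hk => ?_
  rw [Finset.mem_Icc] at hk
  have hk' : k ≤ G.n := hk.2.trans hK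
  rw [stageCost_congr (hx.action_ae_eq_bestAction hγ (Finset.mem_Icc.2 ⟨hk.1, hk'⟩)),
    hx.stageCost_bestAction η hk' _ _ (Λ := G.gain i k) rfl, hx.crossMoment_state hk', Game.V]

theorem posteriorCov_le_stateCov (hx : IsStateProcess G μ x w) (η : Profile m p) {k : ℕ}
    (hk : k ≤ G.n) : posteriorCov μ x η k ≤ G.stateCov k := by
  rw [← hx.crossMoment_state hk]
  exact crossMoment_condExp_le_self (hx.measurable_info η hk).comap_le (hx.memLp_state hk)

/-- More informative signals have a larger posterior covariance. -/
theorem posteriorCov_mono (hx : IsStateProcess G μ x w) {η η' : Profile m p} {k : ℕ}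
    (hk : k ≤ G.n) (h : MeasurableSpace.comap (info η x k) inferInstance
      ≤ MeasurableSpace.comap (info η' x k) inferInstance) :
    posteriorCov μ x η k ≤ posteriorCov μ x η' k :=
  crossMoment_condExp_le h (hx.measurable_info η' hk).comap_le (hx.memLp_state hk)

end IsStateProcess

namespace IsStateProcess

/-- The filter is the receiver's estimate of the state from the linear signals. -/
theorem estimate_ae_eq_stateFilter (hm : 0 < m) (hx : IsStateProcess G μ x w)
    (hS : IsStablePosteriorSeq G S P) (hD : ∀ k < G.n, (G.innovCov S k).PosDef)
    {L M : ℕ → Mat p}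
    (hM : ∀ k < G.n, filterGain (G.innovCov S k) (P (k + 1)) = M k * (L (k + 1))ᵀ)
    (hL : ∀ k < G.n, filterGain (G.innovCov S k) (P (k + 1)) * G.innovCov S k * L (k + 1)
      = G.innovCov S k * L (k + 1)) {k : ℕ} (hk : k ≤ G.n) :
    estimate μ x (fun _ : Fin m => linearPolicy L) k =ᵐ[μ] stateFilter G S P x k := by
  set η : Profile m p := fun _ => linearPolicy L with hη
  have hle := (hx.measurable_info η hk).comap_le
  have hfL : MemLp (stateFilter G S P x k) 2 μ := hx.memLp_stateFilter hk
  have hxL := hx.memLp_state hk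
  have hfi := hfL.integrable one_le_two
  set e := fun ω => x k ω - stateFilter G S P x k ω with he
  have heI := (memLp_sub hxL hfL).integrable one_le_two
  have helin : IsLinearImage (driver G x w) e :=
    (hx.isLinearImage_state hk).sub (hx.isLinearImage_stateFilter hk)
  have hfm : StronglyMeasurable[MeasurableSpace.comap (info η x k) inferInstance]
    (stateFilter G S P x k) := stronglyMeasurable_stateFilter hm hM hk
  have hjn (j : Finset.Icc 1 k) : (j : ℕ) ≤ G.n := (Finset.mem_Icc.1 j.2).2.trans hk
  -- Independence, not mere lack of correlation, is what makes the conditional expectation of the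
  -- error vanish given all Borel functions of the signals.
  have hind : IndepFun e (info η x k) μ := by
    have h1 := IsLinearImage.indepFun hx.hasGaussianLaw_driver hx.integral_driver helin
      (Y := fun (j : Finset.Icc 1 k) ω => Matrix.toEuclideanLin (L j)ᵀ (x j ω))
      (fun j => (hx.isLinearImage_state (hjn j)).toEuclideanLin _) (fun j => by
        rw [crossMoment_mul_right (memLp_sub hxL hfL) (hx.memLp_state (hjn j)),
          Matrix.transpose_transpose]
        exact hx.crossMoment_stateFilter_error hS hD hL hk j.2)
    have h2 : info η x k = (fun (f : Finset.Icc 1 k → Vec p) (_ : Fin m) => f)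
        ∘ fun ω (j : Finset.Icc 1 k) => Matrix.toEuclideanLin (L j)ᵀ (x j ω) := by
      funext ω i j
      exact signal_linearPolicy L x (Finset.mem_Icc.1 j.2).1 ω
    rw [h2]
    exact h1.comp measurable_id (by fun_prop)
  have hem : Measurable e := by
    rw [he]
    exact (hx.measurable_state hk).sub (hfm.mono hle).measurable
  have hE := condExp_indep_eq (μ := μ) hem.comap_le hle
    (comap_measurable e).stronglyMeasurable ((IndepFun_iff_Indep _ _ _).1 hind)
  have he0 : ∫ ω, e ω ∂μ = 0 :=
    helin.integral_eq_zero hx.hasGaussianLaw_driver.integrable hx.integral_driver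
  have hsum : x k = stateFilter G S P x k + e := by
    funext ω
    simp [he]
  have hadd := condExp_add hfi heI (MeasurableSpace.comap (info η x k) inferInstance)
  rw [← hsum, condExp_of_stronglyMeasurable hle hfm hfi] at hadd
  filter_upwards [hadd, hE] with ω h1 h2
  rw [estimate, h1, Pi.add_apply, h2, he0, add_zero]

/-- The common linear policy attains a sequence of stable posteriors. -/
theorem posteriorCov_linearPolicy (hm : 0 < m) (hx : IsStateProcess G μ x w)
    (hS : IsStablePosteriorSeq G S P) (hD : ∀ k < G.n, (G.innovCov S k).PosDef)
    {U L : ℕ → Mat p} {d : ℕ → Fin p → ℝ}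
    (hU : ∀ k ∈ Finset.Icc 1 G.n, U k ∈ Matrix.orthogonalGroup (Fin p) ℝ ∧
      P k = U k * Matrix.diagonal (d k) * (U k)ᵀ)
    (hL : ∀ k < G.n, L (k + 1) =
      (CFC.sqrt (G.innovCov S k))⁻¹ * U (k + 1) * Matrix.diagonal (d (k + 1)))
    {k : ℕ} (hk : k ≤ G.n) :
    posteriorCov μ x (fun _ : Fin m => linearPolicy L) k = S k := by
  have hmem {k : ℕ} (hk : k < G.n) : k + 1 ∈ Finset.Icc 1 G.n :=
    Finset.mem_Icc.2 ⟨by omega, hk⟩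
  -- With `P = U Λ Uᵀ`, the gain is `D^{1/2} U (Λ Uᵀ D^{-1/2}) = (D^{1/2} U) Lᵀ`, which gives `M`.
  have h := hx.estimate_ae_eq_stateFilter hm hS hD (L := L)
    (M := fun k => CFC.sqrt (G.innovCov S k) * U (k + 1)) ?_ ?_ hk
  · exact (crossMoment_congr h h).trans (hx.crossMoment_stateFilter hS hD hk).1
  · intro k hk
    rw [hL k hk, filterGain, (hU _ (hmem hk)).2, Matrix.transpose_mul, Matrix.transpose_mul,
      Mat.sqrt_inv_transpose, Matrix.diagonal_transpose]
    simp only [mul_assoc]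
  · intro k hk
    obtain ⟨hUo, hPU⟩ := hU _ (hmem hk)
    have hUU : (U (k + 1))ᵀ * U (k + 1) = 1 :=
      (Matrix.mem_orthogonalGroup_iff' _ _).1 hUo
    -- Hence `D L = D^{1/2} P U`, which the gain fixes since `P² = P`.
    have hUd : U (k + 1) * Matrix.diagonal (d (k + 1)) = P (k + 1) * U (k + 1) := by
      rw [hPU, mul_assoc _ _ (U (k + 1)), hUU, mul_one]
    have hDL : G.innovCov S k * L (k + 1)
        = CFC.sqrt (G.innovCov S k) * P (k + 1) * U (k + 1) := by
      rw [hL k hk, mul_assoc, hUd, ← mul_assoc, Mat.mul_inv_sqrt (hD k hk), mul_assoc]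
    rw [mul_assoc, hDL, filterGain]
    calc _ = CFC.sqrt (G.innovCov S k) * P (k + 1) * ((CFC.sqrt (G.innovCov S k))⁻¹
          * CFC.sqrt (G.innovCov S k)) * P (k + 1) * U (k + 1) := by simp only [mul_assoc]
      _ = _ := by
        rw [Mat.inv_mul_sqrt (hD k hk), mul_one, mul_assoc (CFC.sqrt _),
          (hS.proj _ (hmem hk)).2]

/-- A common policy whose posterior covariances are stable for every sender is an equilibrium with
every best-response map of the receiver. -/
theorem isMultistageNash (hm : 2 ≤ m) (hx : IsStateProcess G μ x w) {η₀ : SenderPolicy p}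
    (hS : ∀ k ∈ Finset.Icc 1 G.n, ∀ i,
      IsStable (G.stateCov k) (G.V i k) (posteriorCov μ x (fun _ : Fin m => η₀) k))
    {γ : Profile m p → ReceiverPolicy m p t} (hγ : ∀ η, IsBestResponse G μ x η (γ η)) :
    IsMultistageNash G μ x (fun _ => η₀) γ := by
  refine ⟨hγ, fun K hK i ηi => ?_⟩
  rw [Finset.mem_Icc] at hK
  rw [hx.cost_of_isBestResponse (hγ _) i hK.2, hx.cost_of_isBestResponse (hγ _) i hK.2]
  refine Finset.sum_le_sum fun k hk => ENNReal.ofReal_le_ofReal (add_le_add_right ?_ _)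
  rw [Finset.mem_Icc] at hk
  have hk' : k ≤ G.n := hk.2.trans hK.2
  -- The posterior covariance after the deviation is an admissible competitor in the definition of
  -- stability.
  exact (hS k (Finset.mem_Icc.2 ⟨hk.1, hk'⟩) i).2.2 _
    (hx.posteriorCov_mono hk' (comap_info_le_update hm η₀ x k i ηi))
    (hx.posteriorCov_le_stateCov _ hk')

end IsStateProcess

end Equilibrium

end Disclosure

theorem lemma9 {m p t q : ℕ} (hm : 2 ≤ m) (G : Disclosure.Game m p t q)
    {Ω : Type*} [MeasurableSpace Ω] (μ : Measure Ω) [IsProbabilityMeasure μ]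
    (x w : ℕ → Ω → Disclosure.Vec p) (hx : Disclosure.IsStateProcess G μ x w) :
    -- the common linear policy attains every sequence of stable posteriors, in equilibrium
    (∀ S P U : ℕ → Disclosure.Mat p, ∀ d : ℕ → Fin p → ℝ, ∀ L : ℕ → Disclosure.Mat p,
      Disclosure.IsStablePosteriorSeq G S P →
      (∀ k < G.n, (G.innovCov S k).PosDef) →
      (∀ k ∈ Finset.Icc 1 G.n, U k ∈ Matrix.orthogonalGroup (Fin p) ℝ ∧
        P k = U k * Matrix.diagonal (d k) * (U k)ᵀ) →
      (∀ k < G.n, L (k + 1) =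
        (CFC.sqrt (G.innovCov S k))⁻¹ * U (k + 1) * Matrix.diagonal (d (k + 1))) →
      (∀ k ∈ Finset.Icc 1 G.n,
        Disclosure.posteriorCov μ x (fun _ : Fin m => Disclosure.linearPolicy L) k = S k) ∧
      (∃ γ, Disclosure.IsMultistageNash G μ x (fun _ => Disclosure.linearPolicy L) γ) ∧
      ∀ γ : Disclosure.Profile m p → Disclosure.ReceiverPolicy m p t,
        (∀ η, Disclosure.IsBestResponse G μ x η (γ η)) →
        Disclosure.IsMultistageNash G μ x (fun _ => Disclosure.linearPolicy L) γ) ∧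
    -- the outcomes of the greedy algorithm are such sequences
    (∀ (o : Equiv.Perm (Fin m)) (S : ℕ → Disclosure.Mat p), Disclosure.IsGreedyOutput G o S →
      (∀ k < G.n, (G.innovCov S k).PosDef) →
      ∃ P : ℕ → Disclosure.Mat p, Disclosure.IsStablePosteriorSeq G S P) := by
  refine ⟨fun S P U d L hS hD hU hL => ?_,
    fun o S hS hD => hS.exists_isStablePosteriorSeq hD⟩
  have hcov : ∀ k ∈ Finset.Icc 1 G.n,
      Disclosure.posteriorCov μ x (fun _ : Fin m => Disclosure.linearPolicy L) k = S k :=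
    fun k hk => hx.posteriorCov_linearPolicy (by omega) hS hD hU hL (Finset.mem_Icc.1 hk).2
  have hnash : ∀ γ : Disclosure.Profile m p → Disclosure.ReceiverPolicy m p t,
      (∀ η, Disclosure.IsBestResponse G μ x η (γ η)) →
      Disclosure.IsMultistageNash G μ x (fun _ => Disclosure.linearPolicy L) γ :=
    fun γ hγ => hx.isMultistageNash hm (fun k hk i => by
      rw [hcov k hk]
      exact hS.stable k hk i) hγ
  choose γ hγ using hx.exists_isBestResponse
  exact ⟨hcov, ⟨γ, hnash γ hγ⟩, hnash⟩
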